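/- Assume the Lindelöf Hypothesis: for every $\varepsilon>0$, $\zeta(\tfrac12+it)\ll_\varepsilon t^{\varepsilon}$ as $t\to\infty$. Let $X=(x_n)_{n\ge 1}$ be a sequence of positive real numbers such that $x_{n+1}-x_n\ge c$ for some constant $c>0$ and all $n\ge1$, and $x_n\ll n^{C}$ for some constant $C$. Write $\|y\|=\min_{k\in\mathbb Z}|y-k|$, and for $N\ge 2$ and $\alpha\in\mathbb R$ put $$\delta_{\min}^{\alpha}(N)=\min\{\|\alpha x_m-\alpha x_n\| : 1\le m,n\le N,\ m\ne n\},$$ $$E^*(X,N)=\#\{(n_1,n_2,n_3,n_4)\in\{1,\dots,N\}^4 : |x_{n_1}+x_{n_2}-x_{n_3}-x_{n_4}|<1\}.$$ (a) Let $\beta\in\mathbb R$ be such that $E^*(X,N)\ll_\varepsilon N^{\beta+\varepsilon}$ for every $\varepsilon>0$. Then for almost every $\alpha\in\mathbb R$ (with respect to Lebesgue measure) there is a sequence $\eta(N)\to0$, which may depend on $\alpha$, such that $$\delta_{\min}^{\alpha}(N)<\frac1{N^{4-\beta-\eta(N)}}\qquad\text{for all } N\ge2.$$ (b) In particular, if $E^*(X,N)\ll_\varepsilon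 N^{2+\varepsilon}$ for every $\varepsilon>0$ (equivalently, $E^*(X,N)=N^{2+o(1)}$), then for almost every $\alpha\in\mathbb R$ there is a sequence $\eta(N)\to0$, which may depend on $\alpha$, such that $$\delta_{\min}^{\alpha}(N)=\frac1{N^{2+\eta(N)}}\qquad\text{for all } N\ge2.$$ -/

import Mathlib

open Filter Topology MeasureTheory Asymptotics

noncomputable section

/-- The Lindelöf Hypothesis: `ζ(1/2 + it) ≪ t^ε` as `t → ∞`, for every `ε > 0`. -/
def LindelofHypothesis : Prop :=
  ∀ ε : ℝ, 0 < ε →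
    (fun t : ℝ => riemannZeta (1 / 2 + (t : ℂ) * Complex.I)) =O[atTop] (fun t : ℝ => t ^ ε)

/-- The distance from a real number to the nearest integer. -/
def distInt (x : ℝ) : ℝ := |x - (round x : ℝ)|

/-- `distInt x` is the minimum of `|x - k|` over the integers `k`. -/
theorem isLeast_distInt (x : ℝ) : IsLeast (Set.range fun k : ℤ => |x - (k : ℝ)|) (distInt x) := by
  refine ⟨⟨round x, rfl⟩, ?_⟩
  rintro _ ⟨k, rfl⟩
  exact round_le x k

/-- The pairwise distances modulo one between the first `N` terms `y 1, …, y N` of a sequence.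
(Sequences are indexed by the integers `n ≥ 1`; the value `y 0` is never used.) -/
def gapSet (y : ℕ → ℝ) (N : ℕ) : Set ℝ :=
  {d | ∃ m ∈ Finset.Icc 1 N, ∃ n ∈ Finset.Icc 1 N, m ≠ n ∧ d = distInt (y m - y n)}

/-- The minimal gap modulo one of the first `N` terms of a sequence. It is a minimum over a
nonempty finite set as soon as `2 ≤ N`. -/
def minGap (y : ℕ → ℝ) (N : ℕ) : ℝ := sInf (gapSet y N)

/-- For `2 ≤ N` the infimum in `minGap` is attained. -/
theorem isLeast_minGap (y : ℕ → ℝ) {N : ℕ} (hN : 2 ≤ N) :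
    IsLeast (gapSet y N) (minGap y N) := by
  have hne : (gapSet y N).Nonempty :=
    ⟨_, 1, Finset.mem_Icc.2 ⟨le_rfl, by omega⟩, 2, Finset.mem_Icc.2 ⟨by omega, hN⟩,
      by omega, rfl⟩
  have hfin : (gapSet y N).Finite := by
    refine (((Finset.Icc 1 N) ×ˢ (Finset.Icc 1 N)).finite_toSet.image
      (fun p : ℕ × ℕ => distInt (y p.1 - y p.2))).subset ?_
    rintro d ⟨m, hm, n, hn, -, rfl⟩
    exact ⟨(m, n), Finset.mem_coe.2 (Finset.mem_product.2 ⟨hm, hn⟩), rfl⟩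
  exact ⟨hne.csInf_mem hfin, fun d hd => csInf_le hfin.bddBelow hd⟩

/-- The additive energy at scale `γ`: the number of quadruples
`(n₁, n₂, n₃, n₄) ∈ [1, N]⁴` with `|x n₁ + x n₂ - x n₃ - x n₄| < γ`. -/
def additiveEnergyAt (x : ℕ → ℝ) (N : ℕ) (γ : ℝ) : ℕ :=
  ((Finset.Icc 1 N ×ˢ Finset.Icc 1 N ×ˢ Finset.Icc 1 N ×ˢ Finset.Icc 1 N).filter
    fun p : ℕ × ℕ × ℕ × ℕ => |x p.1 + x p.2.1 - x p.2.2.1 - x p.2.2.2| < γ).card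

/-- The additive energy `E*(X, N)`, which is the energy at scale `1`. -/
def additiveEnergy (x : ℕ → ℝ) (N : ℕ) : ℕ := additiveEnergyAt x N 1

/-- `E*(X, N) ≪ N^(β + ε)` for every `ε > 0`, with an implied constant depending on `ε`. -/
def EnergyBound (x : ℕ → ℝ) (β : ℝ) : Prop :=
  ∀ ε : ℝ, 0 < ε →
    (fun N : ℕ => (additiveEnergy x N : ℝ)) =O[atTop] (fun N : ℕ => (N : ℝ) ^ (β + ε))

end

/-! Suppose the minimal gap at `α` is at least `δ`. For every difference `z = x m - x n` the number
`αz` then keeps distance `δ` from the integers, so the window `(αz, e^τ αz]`, with `τ` a small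
multiple of `δ/z`, contains no integer and its discrepancy is minus its expected count. Over a set
`S` of pairs with differences in one dyadic interval `[Z, 2Z)` these discrepancies have one sign and
cannot cancel. By Chebyshev, the measure of such `α` is controlled by the second moment, in `y =
-log α`, of the summed discrepancy (`volume_le_of_floor_eq`).

By Plancherel this moment is the integral of `|ζ(1/2 - 2πiξ)|²` times the squared exponential sum
with frequencies `log z`, times a multiplier that localises to `|ξ| ≲ 1/τ`. The Lindelöf Hypothesis
makes the zeta factor negligible (`LindelofHypothesis.second_moment`). What remains is a smooth
count of pairs with `|log z - log z'| ≲ τ`; up to an exponentially small error these satisfy `|z -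
z'| < 1` and are counted by the additive energy `E`. The measure is therefore at most `E / (|S|² δ)`
up to small powers and negligible terms. Pigeonholing gives `|S| ≥ N^(2 - o(1))`, so `δ = N^(-(4 - β
- ε))` gives a power saving; Borel-Cantelli along powers of two and monotonicity of the gap in `N`
finish the upper bound.

The lower bound for the gap needs neither Lindelöf nor energy: each of at most `N²` pairs has
difference at least `c` and excludes a set of measure `O(δ)`, and `δ = N^(-(2 + ε))` again gives a
power saving. -/

/-! ### Plancherel's theorem on `L¹ ∩ L²` -/

open FourierTransform SchwartzMap in
-- Both sides are locally integrable, so it suffices to pair them with smooth compactly supported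
-- functions. The transform moves onto the test function by the distributional definition on one
-- side and by Fubini on the other.
theorem fourier_toLp_ae_eq {f : ℝ → ℂ} (hf : Integrable f) (hf2 : MemLp f 2) :
    (𝓕 (hf2.toLp f) : Lp ℂ 2 (volume : Measure ℝ)) =ᵐ[volume] 𝓕 f := by
  set F := 𝓕 (hf2.toLp f) with hF
  have hFloc : LocallyIntegrable (F : ℝ → ℂ) :=
    (Lp.memLp F).locallyIntegrable (by norm_num)
  have hcont : Continuous (𝓕 f) :=
    VectorFourier.fourierIntegral_continuous Real.continuous_fourierChar (by fun_prop) hf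
  refine ae_eq_of_integral_contDiff_smul_eq hFloc hcont.locallyIntegrable fun g hg hgs => ?_
  let φ : 𝓢(ℝ, ℂ) := HasCompactSupport.toSchwartzMap
    (f := fun x => (g x : ℂ)) (hgs.comp_left (g := fun r : ℝ => (r : ℂ)) (by simp))
    (Complex.ofRealCLM.contDiff.comp hg)
  have h1 : ∫ x, φ x • F x = ∫ x, (𝓕 φ) x • (hf2.toLp f) x := by
    have := Lp.fourier_toTemperedDistribution_eq (hf2.toLp f)
    have h2 := congrArg (fun T => T φ) this
    simp only [TemperedDistribution.fourier_apply, Lp.toTemperedDistribution_apply] at h2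
    exact h2.symm
  have h3 : ∫ x, (𝓕 φ) x • (hf2.toLp f) x = ∫ x, (𝓕 (φ : ℝ → ℂ)) x • f x := by
    refine integral_congr_ae ?_
    filter_upwards [hf2.coeFn_toLp] with x hx
    rw [hx, SchwartzMap.fourier_coe]
  have h4 : ∫ x, (𝓕 (φ : ℝ → ℂ)) x • f x = ∫ x, φ x • 𝓕 f x := by
    have := VectorFourier.integral_fourierIntegral_smul_eq_flip (L := innerₗ ℝ) (μ := volume)
      (ν := volume) Real.continuous_fourierChar (by fun_prop) φ.integrable hf
    rwa [flip_innerₗ] at this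
  rw [h3, h4] at h1
  exact h1

open FourierTransform in
/-- Plancherel's theorem for functions in `L¹ ∩ L²`. -/
theorem lintegral_enorm_fourier_sq {f : ℝ → ℂ} (hf : Integrable f) (hf2 : MemLp f 2) :
    ∫⁻ ξ, ‖𝓕 f ξ‖ₑ ^ 2 = ∫⁻ y, ‖f y‖ₑ ^ 2 := by
  have h := Lp.norm_fourier_eq (hf2.toLp f)
  rw [Lp.norm_def, Lp.norm_def, ENNReal.toReal_eq_toReal_iff' (Lp.eLpNorm_ne_top _)
    (Lp.eLpNorm_ne_top _), eLpNorm_congr_ae (fourier_toLp_ae_eq hf hf2),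
    eLpNorm_congr_ae hf2.coeFn_toLp] at h
  have h2 : ∀ g : ℝ → ℂ, eLpNorm g 2 volume ^ 2 = ∫⁻ y, ‖g y‖ₑ ^ 2 := fun g => by
    rw [eLpNorm_eq_lintegral_rpow_enorm_toReal (by norm_num) (by norm_num)]
    simp only [ENNReal.toReal_ofNat, ENNReal.rpow_ofNat]
    rw [← ENNReal.rpow_natCast, ← ENNReal.rpow_mul]
    norm_num
  rw [← h2, ← h2, h]

open FourierTransform in
theorem integral_norm_fourier_sq {f : ℝ → ℂ} (hf : Integrable f) (hf2 : MemLp f 2) :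
    Integrable (fun ξ => ‖𝓕 f ξ‖ ^ 2) ∧ ∫ ξ, ‖𝓕 f ξ‖ ^ 2 = ∫ y, ‖f y‖ ^ 2 := by
  have hcont : Continuous (𝓕 f) :=
    VectorFourier.fourierIntegral_continuous Real.continuous_fourierChar (by fun_prop) hf
  have h := lintegral_enorm_fourier_sq hf hf2
  have hi := hf2.integrable_norm_pow (by norm_num)
  have e : ∀ g : ℝ → ℂ, (∫⁻ y, ‖g y‖ₑ ^ 2) = ∫⁻ y, ENNReal.ofReal (‖g y‖ ^ 2) := fun g => by
    refine lintegral_congr fun y => ?_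
    rw [ENNReal.ofReal_pow (norm_nonneg _), ofReal_norm]
  rw [e, e] at h
  refine ⟨⟨by fun_prop, ?_⟩, ?_⟩
  · rw [hasFiniteIntegral_iff_ofReal (Eventually.of_forall fun _ => by positivity), h,
      ← hasFiniteIntegral_iff_ofReal (Eventually.of_forall fun _ => by positivity)]
    exact hi.2
  · rw [integral_eq_lintegral_of_nonneg_ae (Eventually.of_forall fun _ => by positivity)
      (by fun_prop), h, integral_eq_lintegral_of_nonneg_ae
      (Eventually.of_forall fun _ => by positivity) hi.1]

/-! ### The floor error and the zeta function in the critical strip -/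

/-- The negative fractional part `⌊u⌋ - u`, as a complex number. -/
noncomputable def floorError (u : ℝ) : ℂ := (((⌊u⌋ : ℝ) - u : ℝ) : ℂ)

theorem floorError_eq (u : ℝ) : floorError u = -((Int.fract u : ℝ) : ℂ) := by
  rw [floorError, ← Complex.ofReal_neg, Int.fract, neg_sub]

theorem measurable_floorError : Measurable floorError := by
  unfold floorError
  fun_prop

theorem norm_floorError_le_one (u : ℝ) : ‖floorError u‖ ≤ 1 := by
  rw [floorError_eq, norm_neg, Complex.norm_real, Real.norm_eq_abs, Int.abs_fract]
  exact (Int.fract_lt_one u).le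

theorem norm_floorError_le_self {u : ℝ} (hu : 0 ≤ u) : ‖floorError u‖ ≤ u := by
  rw [floorError_eq, norm_neg, Complex.norm_real, Real.norm_eq_abs, Int.abs_fract]
  rw [Int.fract]
  have : (0 : ℝ) ≤ ⌊u⌋ := by exact_mod_cast Int.floor_nonneg.2 hu
  linarith

/-- The fractional part restricted to `(1, ∞)`. -/
noncomputable def fractTail (u : ℝ) : ℂ := (Set.Ioi (1 : ℝ)).indicator (fun u => floorError u) u

theorem locallyIntegrableOn_fractTail : LocallyIntegrableOn fractTail (Set.Ioi 0) := by
  apply LocallyIntegrable.locallyIntegrableOn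
  refine (locallyIntegrable_const (1 : ℝ)).mono
    (measurable_floorError.indicator measurableSet_Ioi).aestronglyMeasurable
    (Eventually.of_forall fun u => ?_)
  rw [fractTail, Set.indicator]
  split_ifs
  · simpa using norm_floorError_le_one u
  · simp

theorem fractTail_isBigO_atTop : fractTail =O[atTop] (fun x : ℝ => x ^ (-(0 : ℝ))) := by
  refine IsBigO.of_bound 1 (Eventually.of_forall fun u => ?_)
  rw [fractTail, Set.indicator]
  split_ifs
  · simpa using norm_floorError_le_one u
  · simp

theorem fractTail_isBigO_zero (b : ℝ) : fractTail =O[𝓝[>] 0] (fun x : ℝ => x ^ (-b)) := by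
  refine IsBigO.of_bound 1 ?_
  filter_upwards [mem_nhdsWithin_of_mem_nhds (Iio_mem_nhds one_pos)] with u hu
  rw [fractTail, Set.indicator_of_notMem (by simpa using le_of_lt hu)]
  simp only [norm_zero]
  positivity

theorem mellinConvergent_fractTail {s : ℂ} (hs : 0 < s.re) : MellinConvergent fractTail (-s) :=
  mellinConvergent_of_isBigO_rpow locallyIntegrableOn_fractTail fractTail_isBigO_atTop
    (by simpa using hs) (fractTail_isBigO_zero (-s.re - 1)) (by simp)

theorem differentiableAt_mellin_fractTail {s : ℂ} (hs : 0 < s.re) :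
    DifferentiableAt ℂ (fun s => mellin fractTail (-s)) s := by
  have : DifferentiableAt ℂ (mellin fractTail) (-s) :=
    mellin_differentiableAt_of_isBigO_rpow locallyIntegrableOn_fractTail fractTail_isBigO_atTop
      (by simpa using hs) (fractTail_isBigO_zero (-s.re - 1)) (by simp)
  exact this.comp s differentiableAt_id.neg

/-- Partial summation gives `ζ(s) = s ∫₁^∞ ⌊t⌋ t^(-s-1) dt`. Replacing `⌊t⌋` by `t` produces
`s/(s-1) = 1 + 1/(s-1)`, whose pole is the one removed in `riemannZeta₀`. -/
theorem riemannZeta₀_eq_of_one_lt_re {s : ℂ} (hs : 1 < s.re) :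
    riemannZeta₀ s = 1 + s * mellin fractTail (-s) := by
  have hs1 : s ≠ 1 := by rintro rfl; simp at hs
  have hs0 : s ≠ 0 := by rintro rfl; simp at hs; linarith
  have h1 := LSeries_eq_mul_integral_of_nonneg (fun _ => 1) zero_le_one hs
    (by
      refine IsBigO.of_bound 1 (Eventually.of_forall fun n => ?_)
      simp) (fun _ => zero_le_one)
  have h2 : LSeries (fun _ => ((1 : ℝ) : ℂ)) s = riemannZeta s := by
    simp only [Complex.ofReal_one]
    exact LSeries_one_eq_riemannZeta hs
  have hconv := mellinConvergent_fractTail (s := s) (by linarith)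
  rw [MellinConvergent] at hconv
  have h3 : mellin fractTail (-s) = ∫ t in Set.Ioi (1 : ℝ), (t : ℂ) ^ (-s - 1) • floorError t := by
    rw [mellin]
    have : ∀ t : ℝ, (t : ℂ) ^ (-s - 1) • fractTail t =
        (Set.Ioi (1 : ℝ)).indicator (fun t : ℝ => (t : ℂ) ^ (-s - 1) • floorError t) t := fun t => by
      rw [fractTail, Set.indicator, Set.indicator]
      split_ifs <;> simp
    simp_rw [this]
    rw [setIntegral_indicator measurableSet_Ioi]
    congr 2
    ext t
    simp only [Set.mem_inter_iff, Set.mem_Ioi]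
    constructor
    · exact fun h => h.2
    · exact fun h => ⟨by linarith, h⟩
  have hint : IntegrableOn (fun t : ℝ => (t : ℂ) ^ (-s - 1) • floorError t) (Set.Ioi 1) := by
    refine (hconv.mono_set (Set.Ioi_subset_Ioi zero_le_one)).congr_fun (fun t ht => ?_)
      measurableSet_Ioi
    simp only [fractTail, Set.indicator_of_mem ht]
  have hint2 : IntegrableOn (fun t : ℝ => (t : ℂ) ^ (-s)) (Set.Ioi 1) :=
    integrableOn_Ioi_cpow_of_lt (by simpa using hs) one_pos
  have h4 : ∫ t in Set.Ioi (1 : ℝ), (∑ k ∈ Finset.Icc 1 ⌊t⌋₊, (((1 : ℝ)) : ℂ)) * (t : ℂ) ^ (-(s + 1))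
      = (∫ t in Set.Ioi (1 : ℝ), (t : ℂ) ^ (-s - 1) • floorError t) +
        ∫ t in Set.Ioi (1 : ℝ), (t : ℂ) ^ (-s) := by
    rw [← integral_add hint hint2]
    refine setIntegral_congr_fun measurableSet_Ioi fun t ht => ?_
    have ht0 : (0 : ℝ) < t := lt_trans one_pos ht
    have e : (t : ℂ) ^ (-s) = (t : ℂ) ^ (-s - 1) * t := by
      rw [Complex.cpow_sub _ _ (by exact_mod_cast ht0.ne'), Complex.cpow_one,
        div_mul_cancel₀ _ (by exact_mod_cast ht0.ne')]
    have e2 : (⌊t⌋₊ : ℝ) = (⌊t⌋ : ℝ) := natCast_floor_eq_intCast_floor ht0.le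
    simp only [Finset.sum_const, Nat.card_Icc, Nat.add_sub_cancel, smul_eq_mul, floorError, e]
    rw [← e2, neg_add']
    push_cast
    simp only [nsmul_eq_mul]
    ring
  rw [h2, h4, ← h3, integral_Ioi_cpow_of_lt (by simpa using hs) one_pos] at h1
  have h5 := riemannZeta_eq_inv_sub_add hs1
  have hs2 : s - 1 ≠ 0 := sub_ne_zero.2 hs1
  rw [h1] at h5
  have h6 : -s + 1 ≠ 0 := fun h => hs2 (by linear_combination -h)
  rw [← sub_eq_iff_eq_add'] at h5
  rw [← h5]
  simp only [Complex.ofReal_one, Complex.one_cpow]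
  field_simp
  have h7 : (-1 + s) ≠ 0 := fun h => hs2 (by linear_combination h)
  ring_nf

/-- Analytic continuation: both sides are analytic on the right half-plane and agree near `2`. -/
theorem riemannZeta₀_eq {s : ℂ} (hs : 0 < s.re) :
    riemannZeta₀ s = 1 + s * mellin fractTail (-s) := by
  have hopen : IsOpen {s : ℂ | 0 < s.re} := isOpen_lt continuous_const Complex.continuous_re
  have hconv : IsPreconnected {s : ℂ | 0 < s.re} := (convex_halfSpace_re_gt 0).isPreconnected
  have h1 : AnalyticOnNhd ℂ riemannZeta₀ {s : ℂ | 0 < s.re} :=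
    differentiable_riemannZeta₀.differentiableOn.analyticOnNhd hopen
  have h2 : AnalyticOnNhd ℂ (fun s => 1 + s * mellin fractTail (-s)) {s : ℂ | 0 < s.re} := by
    refine DifferentiableOn.analyticOnNhd (fun s hs => ?_) hopen
    exact ((differentiableAt_id.mul (differentiableAt_mellin_fractTail hs)).const_add
      1).differentiableWithinAt
  refine h1.eqOn_of_preconnected_of_eventuallyEq h2 hconv (z₀ := 2) (by simp) ?_ hs
  filter_upwards [(isOpen_lt continuous_const Complex.continuous_re).mem_nhds
    (show (1 : ℝ) < (2 : ℂ).re by norm_num)] with z hz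
  exact riemannZeta₀_eq_of_one_lt_re hz

/-- On `(0, 1)` the floor error is `-u`, with transform `-1/(1-s)`, convergent because `s.re < 1`.
Multiplied by `s` this is `1 + 1/(s-1) - 2 + 1` in disguise, that is `s/(s-1)`: it cancels the
constant against `riemannZeta₀_eq` and restores the pole of `ζ`. -/
theorem mellin_floorError {s : ℂ} (hs : 0 < s.re) (hs1 : s.re < 1) :
    mellin floorError (-s) = riemannZeta s / s := by
  have hs0 : s ≠ 0 := by rintro rfl; simp at hs
  have hne1 : s ≠ 1 := by rintro rfl; simp at hs1
  obtain ⟨hc, hv⟩ := hasMellin_cpow_Ioc 1 (s := -s) (by simpa using hs1)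
  have hconv := mellinConvergent_fractTail hs
  have h := hasMellin_sub hconv hc
  have h2 : mellin floorError (-s) = mellin (fun t => fractTail t -
      (Set.Ioc (0 : ℝ) 1).indicator (fun t : ℝ => (t : ℂ) ^ (1 : ℂ)) t) (-s) := by
    refine setIntegral_congr_ae measurableSet_Ioi ?_
    -- At `t = 1` the two integrands really differ, so that point is discarded.
    filter_upwards [compl_mem_ae_iff.2 (measure_singleton (1 : ℝ))] with t ht ht0
    congr 1
    have ht0' : (0 : ℝ) < t := ht0
    rcases lt_or_gt_of_ne (show t ≠ 1 from ht) with h1 | h1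
    · rw [fractTail, Set.indicator_of_notMem (by simpa using h1.le),
        Set.indicator_of_mem (Set.mem_Ioc.2 ⟨ht0', h1.le⟩), floorError,
        Int.floor_eq_zero_iff.2 ⟨ht0'.le, h1⟩]
      simp
    · rw [fractTail, Set.indicator_of_mem (Set.mem_Ioi.2 h1),
        Set.indicator_of_notMem (by simp [h1]), sub_zero]
  rw [h2, h.2, hv, riemannZeta_eq_inv_sub_add hne1, riemannZeta₀_eq hs]
  have h3 : -s + 1 ≠ 0 := fun h => hne1 (by linear_combination -h)
  have h4 : s - 1 ≠ 0 := sub_ne_zero.2 hne1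
  field_simp
  ring

/-! ### Logarithmic coordinates on the critical line -/

/-- The floor error in logarithmic coordinates, normalised for the critical line. -/
noncomputable def logFloorError (y : ℝ) : ℂ := (Real.exp (1 / 2 * y) : ℂ) * floorError (Real.exp (-y))

open FourierTransform in
theorem fourier_logFloorError (ξ : ℝ) :
    𝓕 logFloorError ξ = riemannZeta (1 / 2 - 2 * Real.pi * ξ * Complex.I) /
      (1 / 2 - 2 * Real.pi * ξ * Complex.I) := by
  have h := mellin_eq_fourier floorError (s := -(1 / 2 - 2 * Real.pi * ξ * Complex.I))
  rw [mellin_floorError (by simp) (by simp; norm_num)] at h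
  rw [h]
  have e1 : (-(1 / 2 - 2 * Real.pi * ξ * Complex.I)).re = -(1 / 2) := by simp
  have e2 : (-(1 / 2 - 2 * Real.pi * ξ * Complex.I)).im / (2 * Real.pi) = ξ := by
    simp
  have e3 : logFloorError =
      fun u => Real.exp (- -(1 / 2) * u) • floorError (Real.exp (-u)) := by
    funext y
    rw [logFloorError, neg_neg, Complex.real_smul]
  rw [e1, e2, e3]

/-- The bounds `1` and `u` for the floor error give decay in opposite directions; together they
place the function in `L¹ ∩ L²`. -/
theorem norm_logFloorError_le (y : ℝ) : ‖logFloorError y‖ ≤ Real.exp (-(1 / 2) * |y|) := by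
  rw [logFloorError, norm_mul, Complex.norm_real, Real.norm_eq_abs, abs_of_pos (Real.exp_pos _)]
  rcases le_total 0 y with hy | hy
  · rw [abs_of_nonneg hy]
    calc _ ≤ Real.exp (1 / 2 * y) * Real.exp (-y) := by
          gcongr
          exact norm_floorError_le_self (Real.exp_pos _).le
      _ = _ := by rw [← Real.exp_add]; ring_nf
  · rw [abs_of_nonpos hy]
    calc _ ≤ Real.exp (1 / 2 * y) * 1 := by
          gcongr
          exact norm_floorError_le_one _
      _ = _ := by rw [mul_one]; ring_nf

theorem measurable_logFloorError : Measurable logFloorError := by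
  unfold logFloorError
  exact (by fun_prop : Measurable fun y : ℝ => (Real.exp (1 / 2 * y) : ℂ)).mul
    (measurable_floorError.comp (by fun_prop))

theorem integrable_exp_neg_mul_abs {c : ℝ} (hc : 0 < c) :
    Integrable fun y : ℝ => Real.exp (-c * |y|) := by
  rw [← integrableOn_univ, ← Set.Iic_union_Ioi (a := (0 : ℝ))]
  refine IntegrableOn.union ?_ ?_
  · refine (integrableOn_exp_mul_Iic hc 0).congr_fun (fun y hy => ?_) measurableSet_Iic
    simp only [abs_of_nonpos (Set.mem_Iic.1 hy)]
    ring_nf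
  · refine (integrableOn_exp_mul_Ioi (a := -c) (by linarith) 0).congr_fun (fun y hy => ?_)
      measurableSet_Ioi
    simp only [abs_of_pos (Set.mem_Ioi.1 hy)]

theorem integrable_logFloorError : Integrable logFloorError :=
  (integrable_exp_neg_mul_abs (c := 1 / 2) (by norm_num)).mono'
    measurable_logFloorError.aestronglyMeasurable (Eventually.of_forall norm_logFloorError_le)

theorem memLp_two_logFloorError : MemLp logFloorError 2 := by
  refine (memLp_two_iff_integrable_sq_norm measurable_logFloorError.aestronglyMeasurable).2 ?_
  refine (integrable_exp_neg_mul_abs (c := 1) (by norm_num)).mono'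
    (measurable_logFloorError.norm.pow_const 2).aestronglyMeasurable
    (Eventually.of_forall fun y => ?_)
  rw [Real.norm_of_nonneg (by positivity)]
  calc _ ≤ Real.exp (-(1 / 2) * |y|) ^ 2 := by gcongr; exact norm_logFloorError_le y
    _ = _ := by rw [← Real.exp_nat_mul]; ring_nf

/-! ### Translates, exponential sums and the Lorentzian mean square -/

open FourierTransform in
theorem fourier_comp_sub (f : ℝ → ℂ) (a ξ : ℝ) :
    𝓕 (fun y => f (y - a)) ξ = Complex.exp (-(2 * Real.pi * a * ξ) * Complex.I) * 𝓕 f ξ := by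
  rw [Real.fourier_real_eq_integral_exp_smul, Real.fourier_real_eq_integral_exp_smul,
    ← integral_const_mul]
  refine Eq.trans ?_ (integral_sub_right_eq_self _ a)
  refine integral_congr_ae (Eventually.of_forall fun y => ?_)
  simp only [smul_eq_mul]
  rw [← mul_assoc, ← Complex.exp_add]
  congr 2
  push_cast
  ring

/-- The exponential sum with frequencies `ℓ i`. -/
noncomputable def expSum {ι : Type} (S : Finset ι) (ℓ : ι → ℝ) (ξ : ℝ) : ℂ :=
  ∑ i ∈ S, Complex.exp (-(2 * Real.pi * ℓ i * ξ) * Complex.I)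

theorem norm_expSum_le {ι : Type} (S : Finset ι) (ℓ : ι → ℝ) (ξ : ℝ) :
    ‖expSum S ℓ ξ‖ ≤ S.card := by
  refine (norm_sum_le _ _).trans ?_
  rw [Finset.card_eq_sum_ones, Nat.cast_sum]
  refine Finset.sum_le_sum fun i _ => ?_
  rw [Nat.cast_one, ← Complex.ofReal_ofNat, ← Complex.ofReal_mul, ← Complex.ofReal_mul,
    ← Complex.ofReal_mul, ← Complex.ofReal_neg, Complex.norm_exp_ofReal_mul_I]

section Translates

variable {ι : Type} {f : ℝ → ℂ} (S : Finset ι) (ℓ : ι → ℝ)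

theorem integrable_sum_translates (hf : Integrable f) :
    Integrable (fun y => ∑ i ∈ S, f (y - ℓ i)) :=
  integrable_finsetSum _ fun i _ => hf.comp_sub_right (ℓ i)

theorem memLp_comp_sub (hf : MemLp f 2) (a : ℝ) : MemLp (fun y => f (y - a)) 2 :=
  hf.comp_measurePreserving (measurePreserving_sub_right volume a)

theorem memLp_sum_translates (hf : MemLp f 2) :
    MemLp (fun y => ∑ i ∈ S, f (y - ℓ i)) 2 :=
  memLp_finsetSum _ fun i _ => memLp_comp_sub hf (ℓ i)

open FourierTransform in
theorem fourier_sum_translates (hf : Integrable f) (ξ : ℝ) :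
    𝓕 (fun y => ∑ i ∈ S, f (y - ℓ i)) ξ = expSum S ℓ ξ * 𝓕 f ξ := by
  have h : 𝓕 (fun y => ∑ i ∈ S, f (y - ℓ i)) ξ = ∑ i ∈ S, 𝓕 (fun y => f (y - ℓ i)) ξ := by
    simp only [Real.fourier_real_eq_integral_exp_smul, Finset.smul_sum]
    refine integral_finsetSum _ fun i _ => ?_
    have := (Real.fourierIntegral_convergent_iff (V := ℝ) (μ := volume) (f := fun y => f (y - ℓ i))
      ξ).2 (hf.comp_sub_right (ℓ i))
    refine this.congr (Eventually.of_forall fun y => ?_)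
    simp only [Circle.smul_def, Real.fourierChar_apply]
    congr 3
    simp
    ring
  rw [h, expSum, Finset.sum_mul]
  exact Finset.sum_congr rfl fun i _ => fourier_comp_sub f (ℓ i) ξ

end Translates

section Exponential

/-- The one-sided exponential of decay length `τ`. -/
noncomputable def decayExp (τ y : ℝ) : ℝ :=
  (Set.Ioi (0 : ℝ)).indicator (fun y => Real.exp (-τ⁻¹ * y)) y

variable {τ : ℝ}

theorem measurable_decayExp : Measurable (decayExp τ) :=
  (by fun_prop : Measurable fun y : ℝ => Real.exp (-τ⁻¹ * y)).indicator measurableSet_Ioi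

theorem integrable_decayExp (hτ : 0 < τ) : Integrable (decayExp τ) :=
  (integrable_indicator_iff measurableSet_Ioi).2
    (integrableOn_exp_mul_Ioi (by simpa using hτ) 0)

theorem decayExp_mul_decayExp (a b y : ℝ) :
    decayExp τ (y - a) * decayExp τ (y - b) = (Set.Ioi (max a b)).indicator
      (fun y => Real.exp (τ⁻¹ * (a + b)) * Real.exp (-(2 * τ⁻¹) * y)) y := by
  simp only [decayExp, Set.indicator, Set.mem_Ioi, sub_pos, max_lt_iff]
  split_ifs with h1 h2 h3 h4 h5 <;> try tauto
  · rw [← Real.exp_add, ← Real.exp_add]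
    ring_nf
  all_goals simp

theorem integrable_decayExp_mul (hτ : 0 < τ) (a b : ℝ) :
    Integrable fun y => decayExp τ (y - a) * decayExp τ (y - b) := by
  simp only [decayExp_mul_decayExp]
  refine (integrable_indicator_iff measurableSet_Ioi).2 (Integrable.const_mul ?_ _)
  exact integrableOn_exp_mul_Ioi (by simpa using hτ) _

/-- The autocorrelation of a one-sided exponential is a two-sided one. Its Fourier side has a
Lorentzian as squared modulus, so mean squares of exponential sums become sums over pairs of
frequencies. -/
theorem integral_decayExp_mul (hτ : 0 < τ) (a b : ℝ) :
    ∫ y, decayExp τ (y - a) * decayExp τ (y - b) = τ / 2 * Real.exp (-|a - b| / τ) := by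
  simp only [decayExp_mul_decayExp]
  rw [integral_indicator measurableSet_Ioi, integral_const_mul,
    integral_exp_mul_Ioi (by simpa using hτ), neg_div_neg_eq, mul_div_assoc', ← Real.exp_add]
  have : τ⁻¹ * (a + b) + -(2 * τ⁻¹) * max a b = -|a - b| / τ := by
    rcases le_total a b with h | h
    · rw [max_eq_right h, abs_of_nonpos (by linarith)]
      field_simp
      ring
    · rw [max_eq_left h, abs_of_nonneg (by linarith)]
      field_simp
      ring
  rw [this]
  field_simp

theorem memLp_decayExp (hτ : 0 < τ) : MemLp (fun y => (decayExp τ y : ℂ)) 2 := by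
  refine (memLp_two_iff_integrable_sq_norm
    (Complex.measurable_ofReal.comp measurable_decayExp).aestronglyMeasurable).2 ?_
  have := integrable_decayExp_mul hτ 0 0
  refine this.congr (Eventually.of_forall fun y => ?_)
  simp [sq]

open FourierTransform in
theorem fourier_decayExp (hτ : 0 < τ) (ξ : ℝ) :
    𝓕 (fun y => (decayExp τ y : ℂ)) ξ = 1 / ((τ⁻¹ : ℝ) + 2 * Real.pi * ξ * Complex.I) := by
  rw [Real.fourier_real_eq_integral_exp_smul]
  have : ∀ y : ℝ, Complex.exp ((-2 * Real.pi * y * ξ : ℝ) * Complex.I) • (decayExp τ y : ℂ) =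
      (Set.Ioi (0 : ℝ)).indicator
        (fun y : ℝ => Complex.exp (-(τ⁻¹ + 2 * Real.pi * ξ * Complex.I) * y)) y := fun y => by
    simp only [decayExp, Set.indicator]
    split_ifs
    · rw [smul_eq_mul, Complex.ofReal_exp, ← Complex.exp_add]
      congr 1
      push_cast
      ring
    · simp
  simp_rw [this]
  rw [integral_indicator measurableSet_Ioi, integral_exp_mul_complex_Ioi (by simpa using hτ)]
  rw [Complex.ofReal_zero, mul_zero, Complex.exp_zero, neg_div_neg_eq]

theorem norm_fourier_decayExp_sq (hτ : 0 < τ) (ξ : ℝ) :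
    ‖(1 : ℂ) / ((τ⁻¹ : ℝ) + 2 * Real.pi * ξ * Complex.I)‖ ^ 2 =
      τ ^ 2 / (1 + (2 * Real.pi * τ * ξ) ^ 2) := by
  rw [norm_div, norm_one, div_pow, one_pow, ← Complex.normSq_eq_norm_sq]
  have : (((τ⁻¹ : ℝ) : ℂ) + 2 * Real.pi * ξ * Complex.I) =
      ((τ⁻¹ : ℝ) : ℂ) + ((2 * Real.pi * ξ : ℝ) : ℂ) * Complex.I := by push_cast; ring
  rw [this, Complex.normSq_add_mul_I]
  field_simp

/-- The mean square of an exponential sum against a Lorentzian weight. -/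
theorem integral_lorentzian_mul_expSum_sq {ι : Type} (S : Finset ι) (ℓ : ι → ℝ) (hτ : 0 < τ) :
    Integrable (fun ξ => τ ^ 2 / (1 + (2 * Real.pi * τ * ξ) ^ 2) * ‖expSum S ℓ ξ‖ ^ 2) ∧
    ∫ ξ, τ ^ 2 / (1 + (2 * Real.pi * τ * ξ) ^ 2) * ‖expSum S ℓ ξ‖ ^ 2 =
      τ / 2 * ∑ i ∈ S, ∑ j ∈ S, Real.exp (-|ℓ i - ℓ j| / τ) := by
  have hi : Integrable (fun y => (decayExp τ y : ℂ)) := (integrable_decayExp hτ).ofReal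
  have h := integral_norm_fourier_sq (integrable_sum_translates S ℓ hi)
    (memLp_sum_translates S ℓ (memLp_decayExp hτ))
  have e0 : ∀ ξ, ‖expSum S ℓ ξ * (1 / (((τ⁻¹ : ℝ) : ℂ) + 2 * Real.pi * ξ * Complex.I))‖ ^ 2 =
      τ ^ 2 / (1 + (2 * Real.pi * τ * ξ) ^ 2) * ‖expSum S ℓ ξ‖ ^ 2 := fun ξ => by
    rw [norm_mul, mul_pow, norm_fourier_decayExp_sq hτ, mul_comm]
  simp only [fourier_sum_translates S ℓ hi, fourier_decayExp hτ, e0] at h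
  refine ⟨h.1, h.2.trans ?_⟩
  have e : ∀ y, ‖∑ i ∈ S, (decayExp τ (y - ℓ i) : ℂ)‖ ^ 2 =
      ∑ i ∈ S, ∑ j ∈ S, decayExp τ (y - ℓ i) * decayExp τ (y - ℓ j) := fun y => by
    rw [← Complex.ofReal_sum, Complex.norm_real, Real.norm_eq_abs, sq_abs, sq,
      Finset.sum_mul_sum]
  simp_rw [e]
  rw [integral_finsetSum _ fun i _ => integrable_finsetSum _ fun j _ =>
    integrable_decayExp_mul hτ _ _, Finset.mul_sum]
  refine Finset.sum_congr rfl fun i _ => ?_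
  rw [integral_finsetSum _ fun j _ => integrable_decayExp_mul hτ _ _, Finset.mul_sum]
  exact Finset.sum_congr rfl fun j _ => integral_decayExp_mul hτ _ _

end Exponential

/-! ### Second moment of the discrepancy in short windows -/

/-- The hypothesis covers large positive ordinates; compactness covers bounded ones and conjugation
gives the other sign. The factor `(2π)^ε` comes from `t = 2π|ξ|`. -/
theorem LindelofHypothesis.exists_bound (hLH : LindelofHypothesis) {ε : ℝ} (hε : 0 < ε) :
    ∃ C : ℝ, 0 < C ∧ ∀ ξ : ℝ,
      ‖riemannZeta (1 / 2 - 2 * Real.pi * ξ * Complex.I)‖ ≤ C * (1 + |ξ|) ^ ε := by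
  obtain ⟨C₀, hC₀⟩ := (hLH ε hε).bound
  obtain ⟨T, hT⟩ := eventually_atTop.1 hC₀
  have hcont : Continuous fun t : ℝ => riemannZeta (1 / 2 + (t : ℂ) * Complex.I) := by
    refine continuous_iff_continuousAt.2 fun t => ?_
    refine ContinuousAt.comp (g := riemannZeta) ?_ (by fun_prop)
    refine (differentiableAt_riemannZeta fun h => ?_).continuousAt
    have := congrArg Complex.re h
    norm_num at this
  obtain ⟨M, hM⟩ := (isCompact_Icc (a := (0 : ℝ)) (b := T)).exists_bound_of_continuousOn
    hcont.continuousOn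
  have hpos : ∀ t : ℝ, 0 ≤ t → ‖riemannZeta (1 / 2 + (t : ℂ) * Complex.I)‖ ≤
      (|C₀| + |M|) * (1 + t) ^ ε := fun t ht => by
    have h1 : (1 : ℝ) ≤ (1 + t) ^ ε := Real.one_le_rpow (by linarith) hε.le
    rcases le_total t T with h | h
    · calc _ ≤ M := hM t ⟨ht, h⟩
        _ ≤ |M| * 1 := by rw [mul_one]; exact le_abs_self _
        _ ≤ (|C₀| + |M|) * (1 + t) ^ ε := by
          gcongr
          exact le_add_of_nonneg_left (abs_nonneg _)
    · have h2 : ‖t ^ ε‖ ≤ (1 + t) ^ ε := by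
        rw [Real.norm_of_nonneg (Real.rpow_nonneg ht _)]
        gcongr
        linarith
      calc _ ≤ C₀ * ‖t ^ ε‖ := hT t h
        _ ≤ |C₀| * (1 + t) ^ ε := by
          gcongr
          exact le_abs_self _
        _ ≤ (|C₀| + |M|) * (1 + t) ^ ε := by
          gcongr
          exact le_add_of_nonneg_right (abs_nonneg _)
  refine ⟨(|C₀| + |M| + 1) * (2 * Real.pi) ^ ε, by positivity, fun ξ => ?_⟩
  have h2pi : 1 ≤ 2 * Real.pi := by linarith [Real.pi_gt_three]
  have habs : ‖riemannZeta (1 / 2 - 2 * Real.pi * ξ * Complex.I)‖ =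
      ‖riemannZeta (1 / 2 + ((2 * Real.pi * |ξ| : ℝ) : ℂ) * Complex.I)‖ := by
    rcases le_total 0 ξ with h | h
    · rw [abs_of_nonneg h, ← Complex.norm_conj, ← riemannZeta_conj]
      congr 2
      simp [Complex.conj_ofNat]
    · rw [abs_of_nonpos h]
      congr 2
      push_cast
      ring
  rw [habs]
  calc _ ≤ (|C₀| + |M|) * (1 + 2 * Real.pi * |ξ|) ^ ε := hpos _ (by positivity)
    _ ≤ (|C₀| + |M| + 1) * ((2 * Real.pi) * (1 + |ξ|)) ^ ε := by
      have h1 : 1 + 2 * Real.pi * |ξ| ≤ 2 * Real.pi * (1 + |ξ|) := by linarith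
      exact mul_le_mul (by linarith) (Real.rpow_le_rpow (by positivity) h1 hε.le)
        (by positivity) (by positivity)
    _ = _ := by
      rw [Real.mul_rpow (by positivity) (by positivity)]
      ring

/-- The normalised discrepancy of the integers in `(u, e^τ u]`, where `u = e^(-y)`. -/
noncomputable def windowError (τ y : ℝ) : ℂ :=
  (Real.exp (τ / 2) : ℂ) * logFloorError (y - τ) - logFloorError y

theorem measurable_windowError (τ : ℝ) : Measurable (windowError τ) :=
  ((measurable_logFloorError.comp (by fun_prop)).const_mul _).sub measurable_logFloorError

/-- The weight `e^(τ/2)` undoes the change of normalisation under the shift, so both floor errors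
carry the same factor `e^(y/2)`. -/
theorem windowError_eq (τ y : ℝ) : windowError τ y =
    (Real.exp (y / 2) * ((⌊Real.exp τ * Real.exp (-y)⌋ : ℝ) - ⌊Real.exp (-y)⌋ -
      (Real.exp τ - 1) * Real.exp (-y)) : ℝ) := by
  have e1 : Real.exp (τ / 2) * Real.exp (1 / 2 * (y - τ)) = Real.exp (y / 2) := by
    rw [← Real.exp_add]
    ring_nf
  have e2 : Real.exp (-(y - τ)) = Real.exp τ * Real.exp (-y) := by
    rw [← Real.exp_add]
    ring_nf
  rw [windowError, logFloorError, logFloorError, ← mul_assoc, ← Complex.ofReal_mul, e1, e2,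
    floorError, floorError, one_div_mul_eq_div]
  push_cast
  ring

theorem integrable_windowError (τ : ℝ) : Integrable (windowError τ) :=
  ((integrable_logFloorError.comp_sub_right τ).const_mul _).sub integrable_logFloorError

theorem memLp_windowError (τ : ℝ) : MemLp (windowError τ) 2 :=
  ((memLp_comp_sub memLp_two_logFloorError τ).const_mul _).sub memLp_two_logFloorError

open FourierTransform in
theorem fourier_windowError (τ ξ : ℝ) : 𝓕 (windowError τ) ξ =
    (Complex.exp (τ * (1 / 2 - 2 * Real.pi * ξ * Complex.I)) - 1) /
      (1 / 2 - 2 * Real.pi * ξ * Complex.I) *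
      riemannZeta (1 / 2 - 2 * Real.pi * ξ * Complex.I) := by
  have h : 𝓕 (windowError τ) ξ =
      (Real.exp (τ / 2) : ℂ) * 𝓕 (fun y => logFloorError (y - τ)) ξ - 𝓕 logFloorError ξ := by
    have key : ∀ f : ℝ → ℂ, Integrable f → Integrable fun y : ℝ =>
        Complex.exp ((-2 * Real.pi * y * ξ : ℝ) * Complex.I) • f y := fun f hf => by
      have := (Real.fourierIntegral_convergent_iff (V := ℝ) (μ := volume) (f := f) ξ).2 hf
      refine this.congr (Eventually.of_forall fun y => ?_)
      simp only [Circle.smul_def, Real.fourierChar_apply]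
      congr 3
      simp
      ring
    simp only [Real.fourier_real_eq_integral_exp_smul]
    rw [← integral_const_mul, ← integral_sub]
    · refine integral_congr_ae (Eventually.of_forall fun y => ?_)
      simp only [windowError, smul_eq_mul]
      ring
    · exact (key _ (integrable_logFloorError.comp_sub_right τ)).const_mul _
    · exact key _ integrable_logFloorError
  rw [h, fourier_comp_sub, fourier_logFloorError, ← mul_assoc, Complex.ofReal_exp,
    ← Complex.exp_add]
  have : ((τ / 2 : ℝ) : ℂ) + -(2 * Real.pi * τ * ξ) * Complex.I =
      τ * (1 / 2 - 2 * Real.pi * ξ * Complex.I) := by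
    push_cast
    ring
  rw [this]
  ring

/-- The multiplier `(e^(τs) - 1)/s` has size `O(τ)` while `τ|s| ≤ 1` and `O(1/|s|)` beyond, the
profile of the Lorentzian. The constant `18 = 3² · 2` comes from the second range. -/
theorem norm_window_multiplier_sq_le {τ : ℝ} (hτ : 0 < τ) (hτ1 : τ ≤ 1) (ξ : ℝ) :
    ‖(Complex.exp (τ * (1 / 2 - 2 * Real.pi * ξ * Complex.I)) - 1) /
      (1 / 2 - 2 * Real.pi * ξ * Complex.I)‖ ^ 2 ≤
      18 * (τ ^ 2 / (1 + (2 * Real.pi * τ * ξ) ^ 2)) := by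
  set s : ℂ := 1 / 2 - 2 * Real.pi * ξ * Complex.I with hs
  have hre : s.re = 1 / 2 := by simp [hs]
  have him : s.im = -(2 * Real.pi * ξ) := by simp [hs]
  have hns : (2 * Real.pi * ξ) ^ 2 ≤ ‖s‖ ^ 2 := by
    rw [← Complex.normSq_eq_norm_sq, Complex.normSq_apply, hre, him]
    nlinarith
  have hs0 : 0 < ‖s‖ := norm_pos_iff.2 fun h => by rw [h] at hre; norm_num at hre
  rw [norm_div, div_pow, mul_div_assoc', div_le_div_iff₀ (by positivity) (by positivity)]
  have h1 : 1 + (2 * Real.pi * τ * ξ) ^ 2 ≤ 1 + (τ * ‖s‖) ^ 2 := by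
    nlinarith [mul_le_mul_of_nonneg_left hns (sq_nonneg τ)]
  have hts : ‖(τ : ℂ) * s‖ = τ * ‖s‖ := by
    rw [norm_mul, Complex.norm_real, Real.norm_of_nonneg hτ.le]
  suffices h : ‖Complex.exp (τ * s) - 1‖ ^ 2 * (1 + (τ * ‖s‖) ^ 2) ≤ 18 * (τ * ‖s‖) ^ 2 by
    calc _ ≤ ‖Complex.exp (τ * s) - 1‖ ^ 2 * (1 + (τ * ‖s‖) ^ 2) := by gcongr
      _ ≤ _ := h.trans_eq (by ring)
  rcases le_total (τ * ‖s‖) 1 with h | h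
  · have h2 : ‖Complex.exp (τ * s) - 1‖ ≤ 2 * (τ * ‖s‖) := by
      have := Complex.norm_exp_sub_one_le (x := τ * s) (by rwa [hts])
      rwa [hts] at this
    have h3 : (τ * ‖s‖) ^ 2 ≤ 1 := pow_le_one₀ (by positivity) h
    calc _ ≤ (2 * (τ * ‖s‖)) ^ 2 * (1 + 1) := by gcongr
      _ ≤ _ := by nlinarith [sq_nonneg (τ * ‖s‖)]
  · have h2 : ‖Complex.exp (τ * s) - 1‖ ≤ 3 := by
      refine (norm_sub_le _ _).trans ?_
      rw [Complex.norm_exp, norm_one]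
      have h3 : (τ * s : ℂ).re = τ / 2 := by
        rw [Complex.re_ofReal_mul, hre]
        ring
      rw [h3]
      have h4 : Real.exp (τ / 2) ≤ Real.exp (1 / 2) := Real.exp_le_exp.2 (by linarith)
      have h5 : Real.exp (1 / 2) ^ 2 = Real.exp 1 := by
        rw [← Real.exp_nat_mul]
        norm_num
      nlinarith [Real.exp_one_lt_d9, Real.exp_pos (1 / 2)]
    have h3 : 1 ≤ (τ * ‖s‖) ^ 2 := one_le_pow₀ h
    calc _ ≤ 3 ^ 2 * ((τ * ‖s‖) ^ 2 + (τ * ‖s‖) ^ 2) := by gcongr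
      _ = _ := by ring

/-- `R` is a cutoff. Below it the power is at most `R^(2ε)`. Above it the excess `(u/R)^(2ε)` is at
most `(u/R)^(1/2)` because `ε ≤ 1/4`, and the decay `u^(-2)` of the Lorentzian leaves an integrable
tail that gains `R^(-1/2)`. -/
theorem rpow_mul_lorentzian_le {τ ε R : ℝ} (hτ : 0 < τ) (hτ1 : τ ≤ 1) (hε : 0 < ε)
    (hε4 : ε ≤ 1 / 4) (hR : 1 ≤ R) (ξ : ℝ) :
    ((1 + |ξ|) ^ ε) ^ 2 * (τ ^ 2 / (1 + (2 * Real.pi * τ * ξ) ^ 2)) ≤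
      R ^ (2 * ε) * (τ ^ 2 / (1 + (2 * Real.pi * τ * ξ) ^ 2) +
        2 * R ^ (-(1 / 2) : ℝ) * (1 + ‖ξ‖) ^ (-(3 / 2) : ℝ)) := by
  set u := 1 + |ξ| with hu
  have hu1 : 1 ≤ u := by simp [hu]
  have hR0 : 0 < R := by linarith
  set L := τ ^ 2 / (1 + (2 * Real.pi * τ * ξ) ^ 2) with hL
  have hL0 : 0 ≤ L := by positivity
  have hu2 : (u ^ ε) ^ 2 = u ^ (2 * ε) := by
    rw [← Real.rpow_natCast, ← Real.rpow_mul (by linarith), mul_comm]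
    norm_num
  rw [hu2, Real.norm_eq_abs, ← hu, mul_add]
  rcases le_total u R with h | h
  · have : u ^ (2 * ε) ≤ R ^ (2 * ε) := by gcongr
    have h2 : 0 ≤ R ^ (2 * ε) * (2 * R ^ (-(1 / 2) : ℝ) * u ^ (-(3 / 2) : ℝ)) := by positivity
    nlinarith
  · have hL2 : L ≤ 2 * u ^ (-2 : ℝ) := by
      rw [Real.rpow_neg (by linarith), hL, ← div_eq_mul_inv,
        div_le_div_iff₀ (by positivity) (by positivity)]
      have h1 : u ^ (2 : ℝ) ≤ 2 * (1 + ξ ^ 2) := by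
        rw [Real.rpow_two, hu, ← sq_abs ξ]
        nlinarith [sq_nonneg (1 - |ξ|)]
      have h2 : τ ^ 2 ≤ 1 := pow_le_one₀ hτ.le hτ1
      have h3 : 1 ≤ (2 * Real.pi) ^ 2 := one_le_pow₀ (by linarith [Real.pi_gt_three])
      calc τ ^ 2 * u ^ (2 : ℝ) ≤ τ ^ 2 * (2 * (1 + ξ ^ 2)) := by gcongr
        _ = 2 * (τ ^ 2 + 1 * (τ ^ 2 * ξ ^ 2)) := by ring
        _ ≤ 2 * (1 + (2 * Real.pi) ^ 2 * (τ ^ 2 * ξ ^ 2)) := by gcongr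
        _ = _ := by ring
    have h1 : u ^ (2 * ε) ≤ R ^ (2 * ε) * (R ^ (-(1 / 2) : ℝ) * u ^ (1 / 2 : ℝ)) := by
      have e1 : u = R * (u / R) := by field_simp
      have hur : 1 ≤ u / R := (one_le_div hR0).2 h
      have e2 : R ^ (-(1 / 2) : ℝ) * u ^ (1 / 2 : ℝ) = (u / R) ^ (1 / 2 : ℝ) := by
        rw [Real.div_rpow (by linarith) hR0.le, Real.rpow_neg hR0.le]
        ring
      rw [e2]
      nth_rewrite 1 [e1]
      rw [Real.mul_rpow hR0.le (by linarith)]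
      gcongr
      linarith
    have h3 : u ^ (1 / 2 : ℝ) * u ^ (-2 : ℝ) = u ^ (-(3 / 2) : ℝ) := by
      rw [← Real.rpow_add (by linarith)]
      norm_num
    calc u ^ (2 * ε) * L ≤
        R ^ (2 * ε) * (R ^ (-(1 / 2) : ℝ) * u ^ (1 / 2 : ℝ)) * (2 * u ^ (-2 : ℝ)) := by gcongr
      _ = R ^ (2 * ε) * (2 * R ^ (-(1 / 2) : ℝ) * (u ^ (1 / 2 : ℝ) * u ^ (-2 : ℝ))) := by ring
      _ ≤ _ := by
        rw [h3]
        exact le_add_of_nonneg_left (by positivity)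

/-- Under the Lindelöf Hypothesis, a second moment bound for the discrepancy of the integers in
short multiplicative windows, summed over translates. -/
theorem LindelofHypothesis.second_moment (hLH : LindelofHypothesis) {ε : ℝ} (hε : 0 < ε)
    (hε4 : ε ≤ 1 / 4) :
    ∃ C : ℝ, 0 < C ∧ ∀ {ι : Type} (S : Finset ι) (ℓ : ι → ℝ) (τ R : ℝ), 0 < τ → τ ≤ 1 → 1 ≤ R →
      ∫ y, ‖∑ i ∈ S, windowError τ (y - ℓ i)‖ ^ 2 ≤
        C * R ^ (2 * ε) * (τ * ∑ i ∈ S, ∑ j ∈ S, Real.exp (-|ℓ i - ℓ j| / τ) +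
          (S.card : ℝ) ^ 2 * R ^ (-(1 / 2) : ℝ)) := by
  obtain ⟨C, hC, hζ⟩ := hLH.exists_bound hε
  have hKi : Integrable fun ξ : ℝ => (1 + ‖ξ‖) ^ (-(3 / 2) : ℝ) :=
    integrable_one_add_norm (by norm_num)
  set K := ∫ ξ : ℝ, (1 + ‖ξ‖) ^ (-(3 / 2) : ℝ) with hK
  have hK0 : 0 ≤ K := integral_nonneg fun ξ => by positivity
  refine ⟨18 * C ^ 2 * (1 + 2 * K), by positivity, fun {ι} S ℓ τ R hτ hτ1 hR => ?_⟩
  obtain ⟨hi, he⟩ := integral_norm_fourier_sq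
    (integrable_sum_translates S ℓ (integrable_windowError τ))
    (memLp_sum_translates S ℓ (memLp_windowError τ))
  rw [← he]
  simp only [fourier_sum_translates S ℓ (integrable_windowError τ), fourier_windowError] at hi ⊢
  obtain ⟨hDi, hDe⟩ := integral_lorentzian_mul_expSum_sq S ℓ hτ
  set A : ℝ := (S.card : ℝ)
  have hR0 : 0 < R := by linarith
  -- The exponential sum is kept in the Lorentzian term, where its mean square is known, and bounded
  -- trivially by `A` in the tail.
  have hmaj : ∀ ξ : ℝ, ‖expSum S ℓ ξ *
      ((Complex.exp (τ * (1 / 2 - 2 * Real.pi * ξ * Complex.I)) - 1) /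
      (1 / 2 - 2 * Real.pi * ξ * Complex.I) *
      riemannZeta (1 / 2 - 2 * Real.pi * ξ * Complex.I))‖ ^ 2 ≤
      18 * C ^ 2 * R ^ (2 * ε) * (τ ^ 2 / (1 + (2 * Real.pi * τ * ξ) ^ 2) * ‖expSum S ℓ ξ‖ ^ 2 +
        2 * A ^ 2 * R ^ (-(1 / 2) : ℝ) * (1 + ‖ξ‖) ^ (-(3 / 2) : ℝ)) := fun ξ => by
    rw [norm_mul, norm_mul, mul_pow, mul_pow]
    have h1 := norm_window_multiplier_sq_le hτ hτ1 ξ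
    have h2 := hζ ξ
    have h3 := rpow_mul_lorentzian_le hτ hτ1 hε hε4 hR ξ
    have h4 := norm_expSum_le S ℓ ξ
    calc _ ≤ ‖expSum S ℓ ξ‖ ^ 2 * (18 * (τ ^ 2 / (1 + (2 * Real.pi * τ * ξ) ^ 2)) *
          (C * (1 + |ξ|) ^ ε) ^ 2) := by gcongr
      _ = 18 * C ^ 2 * ‖expSum S ℓ ξ‖ ^ 2 *
          (((1 + |ξ|) ^ ε) ^ 2 * (τ ^ 2 / (1 + (2 * Real.pi * τ * ξ) ^ 2))) := by ring
      _ ≤ 18 * C ^ 2 * ‖expSum S ℓ ξ‖ ^ 2 * (R ^ (2 * ε) *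
          (τ ^ 2 / (1 + (2 * Real.pi * τ * ξ) ^ 2) +
            2 * R ^ (-(1 / 2) : ℝ) * (1 + ‖ξ‖) ^ (-(3 / 2) : ℝ))) := by gcongr
      _ = 18 * C ^ 2 * R ^ (2 * ε) * (τ ^ 2 / (1 + (2 * Real.pi * τ * ξ) ^ 2) *
          ‖expSum S ℓ ξ‖ ^ 2 + 2 * ‖expSum S ℓ ξ‖ ^ 2 * R ^ (-(1 / 2) : ℝ) *
            (1 + ‖ξ‖) ^ (-(3 / 2) : ℝ)) := by ring
      _ ≤ _ := by gcongr
  refine (integral_mono hi ((hDi.add (hKi.const_mul _)).const_mul _) hmaj).trans ?_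
  rw [integral_const_mul, integral_add' hDi (hKi.const_mul _), hDe, integral_const_mul, ← hK]
  set W := ∑ i ∈ S, ∑ j ∈ S, Real.exp (-|ℓ i - ℓ j| / τ)
  have hS0 : 0 ≤ W := Finset.sum_nonneg fun i _ => Finset.sum_nonneg fun j _ => by positivity
  have e : 18 * C ^ 2 * (1 + 2 * K) * R ^ (2 * ε) * (τ * W + A ^ 2 * R ^ (-(1 / 2) : ℝ)) -
      18 * C ^ 2 * R ^ (2 * ε) * (τ / 2 * W + 2 * A ^ 2 * R ^ (-(1 / 2) : ℝ) * K) =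
      18 * C ^ 2 * R ^ (2 * ε) * (τ / 2 * W + 2 * K * (τ * W) + A ^ 2 * R ^ (-(1 / 2) : ℝ)) := by
    ring
  have : 0 ≤ 18 * C ^ 2 * R ^ (2 * ε) *
      (τ / 2 * W + 2 * K * (τ * W) + A ^ 2 * R ^ (-(1 / 2) : ℝ)) := by positivity
  linarith

/-! ### From large gaps to a measure bound -/

theorem distInt_le (u : ℝ) (k : ℤ) : distInt u ≤ |u - k| := round_le u k

theorem distInt_nonneg (u : ℝ) : 0 ≤ distInt u := abs_nonneg _

theorem floor_eq_of_le_distInt {u v δ : ℝ} (huv : u ≤ v) (hδ : v - u < δ) (h : δ ≤ distInt u) :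
    ⌊v⌋ = ⌊u⌋ := by
  by_contra hne
  have hlt : ⌊u⌋ < ⌊v⌋ := lt_of_le_of_ne (Int.floor_mono huv) (Ne.symm hne)
  have h1 : u < ⌊v⌋ := Int.floor_lt.1 hlt
  have h2 : (⌊v⌋ : ℝ) ≤ v := Int.floor_le v
  have h3 := distInt_le u ⌊v⌋
  rw [abs_of_neg (by linarith)] at h3
  linarith

theorem volume_exp_neg_image_le {T : Set ℝ} (hT : MeasurableSet T) {K : ℝ} (hK : 0 < K)
    (h : ∀ y ∈ T, -Real.log K ≤ y) :
    volume ((fun y => Real.exp (-y)) '' T) ≤ ENNReal.ofReal K * volume T := by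
  have hder : ∀ y ∈ T, HasDerivWithinAt (fun y => Real.exp (-y)) (Real.exp (-y) * -1) T y :=
    fun y _ => ((hasDerivAt_neg y).exp).hasDerivWithinAt
  have hinj : Set.InjOn (fun y => Real.exp (-y)) T := fun a _ b _ hab => by
    simpa using hab
  have := lintegral_image_eq_lintegral_abs_deriv_mul hT hder hinj (fun _ => 1)
  rw [setLIntegral_one] at this
  rw [this, ← setLIntegral_const]
  refine setLIntegral_mono' hT fun y hy => ?_
  rw [mul_one]
  refine ENNReal.ofReal_le_ofReal ?_
  rw [mul_neg_one, abs_neg, abs_of_pos (Real.exp_pos _), ← Real.exp_log hK]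
  exact Real.exp_le_exp.2 (by linarith [h y hy])

/-- If the multiplicative windows `(α z, e^τ α z]` contain no integers for `α` in `B`, then `B` is
small in terms of a second moment. -/
theorem volume_le_of_floor_eq {ι : Type} (S : Finset ι) (z : ι → ℝ) {Z K τ : ℝ} (hS : S.Nonempty)
    (hZ : 0 < Z) (hz : ∀ i ∈ S, Z ≤ z i) (hK : 1 ≤ K) (hτ : 0 < τ) {B : Set ℝ}
    (hB : B ⊆ Set.Icc (1 / K) K)
    (hfloor : ∀ α ∈ B, ∀ i ∈ S, ⌊Real.exp τ * (α * z i)⌋ = ⌊α * z i⌋) :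
    volume B ≤ ENNReal.ofReal (K ^ 2 / ((S.card : ℝ) ^ 2 * Z * τ ^ 2) *
      ∫ y, ‖∑ i ∈ S, windowError τ (y - Real.log (z i))‖ ^ 2) := by
  set A : ℝ := (S.card : ℝ)
  have hA : 0 < A := Nat.cast_pos.2 hS.card_pos
  set H : ℝ → ℂ := fun y => ∑ i ∈ S, windowError τ (y - Real.log (z i)) with hH
  have hK0 : 0 < K := by linarith
  -- The threshold is the square of the lower bound `A τ √(Z/K)` proved in `hlow`.
  set lam : ℝ := A ^ 2 * Z * τ ^ 2 / K with hlam
  have hlam0 : 0 < lam := by positivity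
  have hHm : Measurable H := Finset.measurable_sum _ fun i _ =>
    (measurable_windowError τ).comp (by fun_prop)
  have hHi : Integrable fun y => ‖H y‖ ^ 2 :=
    (memLp_sum_translates S _ (memLp_windowError τ)).integrable_norm_pow (by norm_num)
  set T : Set ℝ := {y | lam ≤ ‖H y‖ ^ 2} with hT
  have hTm : MeasurableSet T := measurableSet_le measurable_const (hHm.norm.pow_const 2)
  have hmarkov := mul_meas_ge_le_integral_of_nonneg
    (Eventually.of_forall fun y => by positivity) hHi lam
  have hTfin : volume T ≠ ⊤ := (hHi.measure_ge_lt_top hlam0).ne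
  have hsub : B ⊆ (fun y => Real.exp (-y)) '' (T ∩ Set.Ici (-Real.log K)) := by
    intro α hα
    obtain ⟨hα1, hα2⟩ := hB hα
    have hα0 : 0 < α := lt_of_lt_of_le (by positivity) hα1
    refine ⟨-Real.log α, ⟨?_, ?_⟩, by simp [Real.exp_log hα0]⟩
    -- With no integer in the window, only the expected count survives. It has the same sign for
    -- every `i`, so the norm of the sum is the sum of the norms.
    · have hterm : ∀ i ∈ S, windowError τ (-Real.log α - Real.log (z i)) =
          ((-((Real.exp τ - 1) * Real.sqrt (α * z i)) : ℝ) : ℂ) := fun i hi => by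
        have hzi : 0 < z i := hZ.trans_le (hz i hi)
        have hu : 0 < α * z i := by positivity
        have e1 : -(-Real.log α - Real.log (z i)) = Real.log (α * z i) := by
          rw [Real.log_mul hα0.ne' hzi.ne']
          ring
        have e2 : Real.exp ((-Real.log α - Real.log (z i)) / 2) = (Real.sqrt (α * z i))⁻¹ := by
          rw [← neg_neg (-Real.log α - Real.log (z i)), e1, neg_div, Real.exp_neg, Real.exp_half,
            Real.exp_log hu]
        have hs : 0 < Real.sqrt (α * z i) := Real.sqrt_pos.2 hu
        rw [windowError_eq, e1, e2, Real.exp_log hu, hfloor α hα i hi]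
        congr 1
        rw [sub_self, zero_sub]
        nth_rewrite 2 [← Real.mul_self_sqrt hu.le]
        field_simp
      have hval : ‖H (-Real.log α)‖ = ∑ i ∈ S, (Real.exp τ - 1) * Real.sqrt (α * z i) := by
        simp only [hH]
        rw [Finset.sum_congr rfl hterm, ← Complex.ofReal_sum, Complex.norm_real, Finset.sum_neg_distrib,
          norm_neg, Real.norm_of_nonneg]
        exact Finset.sum_nonneg fun i _ => mul_nonneg (by linarith [Real.add_one_le_exp τ])
          (Real.sqrt_nonneg _)
      have hlow : A * (τ * Real.sqrt (Z / K)) ≤ ‖H (-Real.log α)‖ := by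
        rw [hval, ← nsmul_eq_mul]
        refine Finset.card_nsmul_le_sum _ _ _ fun i hi => ?_
        have h1 : τ ≤ Real.exp τ - 1 := by linarith [Real.add_one_le_exp τ]
        have h2 : Z / K ≤ α * z i := by
          rw [div_eq_mul_one_div, mul_comm]
          exact mul_le_mul hα1 (hz i hi) hZ.le hα0.le
        exact mul_le_mul h1 (Real.sqrt_le_sqrt h2) (Real.sqrt_nonneg _) (by linarith)
      calc lam = (A * (τ * Real.sqrt (Z / K))) ^ 2 := by
            rw [mul_pow, mul_pow, Real.sq_sqrt (by positivity), hlam]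
            ring
        _ ≤ _ := by gcongr
    · rw [Set.mem_Ici, neg_le_neg_iff]
      exact Real.log_le_log hα0 hα2
  have hreal : volume.real T ≤ (∫ y, ‖H y‖ ^ 2) / lam := by
    rw [le_div_iff₀ hlam0, mul_comm]
    exact hmarkov
  calc volume B ≤ volume ((fun y => Real.exp (-y)) '' (T ∩ Set.Ici (-Real.log K))) :=
        measure_mono hsub
    _ ≤ ENNReal.ofReal K * volume (T ∩ Set.Ici (-Real.log K)) :=
        volume_exp_neg_image_le (hTm.inter measurableSet_Ici) hK0 fun y hy => hy.2
    _ ≤ ENNReal.ofReal K * volume T := by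
        gcongr
        exact Set.inter_subset_left
    _ = ENNReal.ofReal (K * volume.real T) := by
        rw [ENNReal.ofReal_mul hK0.le, ofReal_measureReal hTfin]
    _ ≤ ENNReal.ofReal (K * ((∫ y, ‖H y‖ ^ 2) / lam)) :=
        ENNReal.ofReal_le_ofReal (by gcongr)
    _ = _ := by
        congr 1
        rw [hlam]
        field_simp
        rfl

theorem abs_sub_div_le_abs_log_sub {a b Z : ℝ} (ha : 0 < a) (hb : 0 < b) (haZ : a ≤ Z)
    (hbZ : b ≤ Z) : |a - b| / Z ≤ |Real.log a - Real.log b| := by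
  wlog h : b ≤ a generalizing a b
  · rw [abs_sub_comm, abs_sub_comm (Real.log a)]
    exact this hb ha hbZ haZ (le_of_not_ge h)
  rw [abs_of_nonneg (by linarith), abs_of_nonneg (sub_nonneg.2 (Real.log_le_log hb h)),
    ← Real.log_div ha.ne' hb.ne']
  calc (a - b) / Z ≤ (a - b) / a := by
        gcongr
    _ = 1 - (a / b)⁻¹ := by field_simp
    _ ≤ _ := Real.one_sub_inv_le_log_of_pos (by positivity)

theorem card_close_pairs_le_additiveEnergy (x : ℕ → ℝ) {N : ℕ} {S : Finset (ℕ × ℕ)}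
    (hS : S ⊆ Finset.Icc 1 N ×ˢ Finset.Icc 1 N) :
    ((S ×ˢ S).filter fun q : (ℕ × ℕ) × (ℕ × ℕ) =>
      |(x q.1.1 - x q.1.2) - (x q.2.1 - x q.2.2)| < 1).card ≤ additiveEnergy x N := by
  -- Uses `(x a - x b) - (x c - x d) = x a + x d - x b - x c`.
  refine Finset.card_le_card_of_injOn (fun q => (q.1.1, q.2.2, q.1.2, q.2.1)) ?_ ?_
  · rintro ⟨⟨a, b⟩, ⟨c, d⟩⟩ hq
    simp only [Finset.coe_filter, Finset.mem_product, Set.mem_ofPred_eq] at hq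
    obtain ⟨⟨h1, h2⟩, h3⟩ := hq
    have h1' := Finset.mem_product.1 (hS h1)
    have h2' := Finset.mem_product.1 (hS h2)
    simp only [Finset.coe_filter, Finset.mem_product, Set.mem_ofPred_eq]
    refine ⟨⟨h1'.1, h2'.2, h1'.2, h2'.1⟩, ?_⟩
    convert h3 using 2
    ring
  · rintro ⟨⟨a, b⟩, ⟨c, d⟩⟩ _ ⟨⟨a', b'⟩, ⟨c', d'⟩⟩ _ h
    simp only [Prod.mk.injEq] at h ⊢
    tauto

/-- Pairs of differences within distance `1` contribute at most `1` each. For the others the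
logarithms differ by at least `1/(2Z) ≥ wτ`, so each contributes at most `e^(-w)`. -/
theorem sum_exp_neg_le_additiveEnergy (x : ℕ → ℝ) {N : ℕ} {S : Finset (ℕ × ℕ)}
    (hS : S ⊆ Finset.Icc 1 N ×ˢ Finset.Icc 1 N) {Z τ w : ℝ} (hZ : 0 < Z) (hτ : 0 < τ)
    (hw : w * (2 * Z * τ) ≤ 1)
    (hz : ∀ p ∈ S, Z ≤ x p.1 - x p.2 ∧ x p.1 - x p.2 ≤ 2 * Z) :
    ∑ p ∈ S, ∑ q ∈ S,
      Real.exp (-|Real.log (x p.1 - x p.2) - Real.log (x q.1 - x q.2)| / τ) ≤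
      additiveEnergy x N + (S.card : ℝ) ^ 2 * Real.exp (-w) := by
  rw [← Finset.sum_product' (f := fun p q : ℕ × ℕ =>
      Real.exp (-|Real.log (x p.1 - x p.2) - Real.log (x q.1 - x q.2)| / τ)),
    ← Finset.sum_filter_add_sum_filter_not (S ×ˢ S) fun q : (ℕ × ℕ) × (ℕ × ℕ) =>
      |(x q.1.1 - x q.1.2) - (x q.2.1 - x q.2.2)| < 1]
  refine add_le_add ?_ ?_
  · refine (Finset.sum_le_card_nsmul _ _ 1 fun q _ => ?_).trans ?_
    · rw [Real.exp_le_one_iff]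
      exact div_nonpos_of_nonpos_of_nonneg (neg_nonpos.2 (abs_nonneg _)) hτ.le
    · rw [nsmul_eq_mul, mul_one]
      exact_mod_cast card_close_pairs_le_additiveEnergy x hS
  · refine (Finset.sum_le_card_nsmul _ _ (Real.exp (-w)) fun q hq => ?_).trans ?_
    · rw [Finset.mem_filter, Finset.mem_product, not_lt] at hq
      obtain ⟨⟨h1, h2⟩, h3⟩ := hq
      obtain ⟨ha, ha'⟩ := hz _ h1
      obtain ⟨hb, hb'⟩ := hz _ h2
      have h4 := abs_sub_div_le_abs_log_sub (hZ.trans_le ha) (hZ.trans_le hb) ha' hb'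
      rw [Real.exp_le_exp, neg_div, neg_le_neg_iff, le_div_iff₀ hτ]
      refine le_trans ?_ h4
      rw [le_div_iff₀ (by positivity)]
      linarith
    · rw [nsmul_eq_mul]
      refine mul_le_mul_of_nonneg_right ?_ (Real.exp_pos _).le
      calc _ ≤ (((S ×ˢ S).card : ℕ) : ℝ) := by exact_mod_cast Finset.card_filter_le _ _
        _ = _ := by rw [Finset.card_product]; push_cast; ring

/-- The set of `α` in `[1/K, K]` for which the minimal gap is at least `δ`. -/
def largeGapSet (x : ℕ → ℝ) (N : ℕ) (K δ : ℝ) : Set ℝ :=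
  {α | α ∈ Set.Icc (1 / K) K ∧ δ ≤ minGap (fun n => α * x n) N}

theorem minGap_le_distInt (y : ℕ → ℝ) {m n N : ℕ} (hm : m ∈ Finset.Icc 1 N)
    (hn : n ∈ Finset.Icc 1 N) (hmn : m ≠ n) : minGap y N ≤ distInt (y m - y n) := by
  have hN : 2 ≤ N := by
    rw [Finset.mem_Icc] at hm hn
    omega
  exact (isLeast_minGap y hN).2 ⟨m, hm, n, hn, hmn, rfl⟩

theorem LindelofHypothesis.volume_largeGapSet_le (hLH : LindelofHypothesis) {ε : ℝ} (hε : 0 < ε)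
    (hε4 : ε ≤ 1 / 4) :
    ∃ C : ℝ, 0 < C ∧ ∀ (x : ℕ → ℝ) (N : ℕ) (S : Finset (ℕ × ℕ)) (Z K δ R : ℝ),
      S ⊆ Finset.Icc 1 N ×ˢ Finset.Icc 1 N → S.Nonempty → (∀ p ∈ S, p.1 ≠ p.2) →
      (∀ p ∈ S, Z ≤ x p.1 - x p.2 ∧ x p.1 - x p.2 < 2 * Z) →
      0 < Z → 1 ≤ K → 1 ≤ K * Z → 0 < δ → δ ≤ 1 → 1 ≤ R →
      volume (largeGapSet x N K δ) ≤ ENNReal.ofReal (C * K ^ 4 * R ^ (2 * ε) *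
        (additiveEnergy x N / ((S.card : ℝ) ^ 2 * δ) + Real.exp (-(1 / δ)) / δ +
          Z * R ^ (-(1 / 2) : ℝ) / δ ^ 2)) := by
  obtain ⟨C, hC, h2⟩ := hLH.second_moment hε hε4
  refine ⟨16 * C, by positivity, fun x N S Z K δ R hS hne hpne hz hZ hK hKZ hδ hδ1 hR => ?_⟩
  have hK0 : 0 < K := by linarith
  have hR0 : 0 < R := by linarith
  -- Since `αz < 2KZ` and `e^τ - 1 ≤ 2τ`, this makes every window shorter than `2τ · 2KZ = δ`.
  set τ := δ / (4 * K * Z) with hτ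
  have hτ0 : 0 < τ := by positivity
  have hτ1 : τ ≤ 1 := by
    rw [hτ, div_le_one (by positivity)]
    nlinarith
  have hA : (0 : ℝ) < S.card := by exact_mod_cast hne.card_pos
  refine (volume_le_of_floor_eq S (fun p => x p.1 - x p.2) hne hZ (fun p hp => (hz p hp).1) hK hτ0
    (fun α hα => hα.1) ?_).trans (ENNReal.ofReal_le_ofReal ?_)
  · rintro α ⟨⟨hα1, hα2⟩, hα⟩ p hp
    obtain ⟨hp1, hp2⟩ := hz p hp
    have hα0 : 0 < α := lt_of_lt_of_le (by positivity) hα1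
    have hu : 0 < α * (x p.1 - x p.2) := mul_pos hα0 (by linarith)
    have hexp : Real.exp τ - 1 ≤ 2 * τ := by
      have := Real.abs_exp_sub_one_le (x := τ) (by rwa [abs_of_pos hτ0])
      rw [abs_of_pos hτ0] at this
      exact (le_abs_self _).trans this
    have hexp1 : 1 ≤ Real.exp τ := Real.one_le_exp hτ0.le
    refine floor_eq_of_le_distInt (δ := δ) ?_ ?_ ?_
    · exact le_mul_of_one_le_left hu.le hexp1
    · have hub : α * (x p.1 - x p.2) < K * (2 * Z) := by
        calc _ < α * (2 * Z) := by gcongr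
          _ ≤ _ := by gcongr
      calc Real.exp τ * (α * (x p.1 - x p.2)) - α * (x p.1 - x p.2) =
            (Real.exp τ - 1) * (α * (x p.1 - x p.2)) := by ring
        _ ≤ 2 * τ * (α * (x p.1 - x p.2)) := by gcongr
        _ < 2 * τ * (K * (2 * Z)) := by gcongr
        _ = δ := by
          rw [hτ]
          field_simp
          norm_num
    · have h3 := Finset.mem_product.1 (hS hp)
      have h4 := minGap_le_distInt (fun n => α * x n) h3.1 h3.2 (hpne p hp)
      rw [mul_sub]
      exact hα.trans h4
  · have h5 := h2 S (fun p => Real.log (x p.1 - x p.2)) τ R hτ0 hτ1 hR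
    have h6 := sum_exp_neg_le_additiveEnergy x hS (w := 1 / δ) hZ hτ0 (by
      rw [hτ]
      have : 1 / δ * (2 * Z * (δ / (4 * K * Z))) = 1 / (2 * K) := by
        field_simp
        norm_num
      rw [this, div_le_one (by positivity)]
      linarith) (fun p hp => ⟨(hz p hp).1, (hz p hp).2.le⟩)
    have h7 : ∫ y, ‖∑ p ∈ S, windowError τ (y - Real.log (x p.1 - x p.2))‖ ^ 2 ≤
        C * R ^ (2 * ε) * (τ * (additiveEnergy x N + (S.card : ℝ) ^ 2 * Real.exp (-(1 / δ))) +
          (S.card : ℝ) ^ 2 * R ^ (-(1 / 2) : ℝ)) := by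
      refine h5.trans ?_
      gcongr
    calc K ^ 2 / ((S.card : ℝ) ^ 2 * Z * τ ^ 2) *
          ∫ y, ‖∑ p ∈ S, windowError τ (y - Real.log (x p.1 - x p.2))‖ ^ 2
        ≤ K ^ 2 / ((S.card : ℝ) ^ 2 * Z * τ ^ 2) * (C * R ^ (2 * ε) *
          (τ * (additiveEnergy x N + (S.card : ℝ) ^ 2 * Real.exp (-(1 / δ))) +
          (S.card : ℝ) ^ 2 * R ^ (-(1 / 2) : ℝ))) := by gcongr
      _ = C * R ^ (2 * ε) * (4 * K ^ 3 * (additiveEnergy x N / ((S.card : ℝ) ^ 2 * δ)) +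
          4 * K ^ 3 * (Real.exp (-(1 / δ)) / δ) +
          16 * K ^ 4 * (Z * R ^ (-(1 / 2) : ℝ) / δ ^ 2)) := by
        rw [hτ]
        field_simp
        ring
      _ ≤ C * R ^ (2 * ε) * (16 * K ^ 4 * (additiveEnergy x N / ((S.card : ℝ) ^ 2 * δ)) +
          16 * K ^ 4 * (Real.exp (-(1 / δ)) / δ) +
          16 * K ^ 4 * (Z * R ^ (-(1 / 2) : ℝ) / δ ^ 2)) := by
        have h8 : 4 * K ^ 3 ≤ 16 * K ^ 4 := by
          have : K ^ 3 ≤ K ^ 4 := pow_le_pow_right₀ hK (by norm_num)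
          have : 0 ≤ K ^ 4 := by positivity
          linarith
        gcongr
      _ = _ := by ring

/-! ### A dyadic class of differences and the choice of parameters -/

theorem add_le_of_gap {x : ℕ → ℝ} {c : ℝ} (hc : 0 < c)
    (hgap : ∀ n : ℕ, 1 ≤ n → c ≤ x (n + 1) - x n) {m n : ℕ} (hn : 1 ≤ n) (hnm : n < m) :
    c ≤ x m - x n := by
  induction m, hnm using Nat.le_induction with
  | base => exact hgap n hn
  | succ m hm ih => linarith [hgap m (by omega)]

theorem exists_growth_bound {x : ℕ → ℝ} (hgrowth : ∃ C : ℝ, x =O[atTop] (fun n : ℕ => (n : ℝ) ^ C)) :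
    ∃ C D : ℝ, 0 < C ∧ 0 ≤ D ∧ ∀ n : ℕ, 1 ≤ n → x n ≤ C * (n : ℝ) ^ D := by
  obtain ⟨D, hD⟩ := hgrowth
  obtain ⟨C, hC, h⟩ := bound_of_isBigO_nat_atTop hD
  -- A nonnegative exponent makes the bound monotone in `n`.
  refine ⟨C, max D 0, hC, le_max_right _ _, fun n hn => ?_⟩
  have hn1 : (1 : ℝ) ≤ n := by exact_mod_cast hn
  have hpos : 0 < (n : ℝ) ^ D := by positivity
  calc x n ≤ ‖x n‖ := le_abs_self _
    _ ≤ C * ‖(n : ℝ) ^ D‖ := h hpos.ne'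
    _ = C * (n : ℝ) ^ D := by rw [Real.norm_of_nonneg hpos.le]
    _ ≤ _ := by
      gcongr
      exact le_max_left _ _

/-- A positive proportion, up to `N ^ η`, of the pairs has its difference in one dyadic interval. -/
theorem exists_dyadic_class {x : ℕ → ℝ} (hpos : ∀ n : ℕ, 1 ≤ n → 0 < x n) {c C D : ℝ}
    (hc : 0 < c) (hgap : ∀ n : ℕ, 1 ≤ n → c ≤ x (n + 1) - x n) (hC : 0 < C) (hD : 0 ≤ D)
    (hgrowth : ∀ n : ℕ, 1 ≤ n → x n ≤ C * (n : ℝ) ^ D) {η : ℝ} (hη : 0 < η) :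
    ∃ M : ℝ, 0 < M ∧ ∀ N : ℕ, 2 ≤ N → ∃ (Z : ℝ) (S : Finset (ℕ × ℕ)), c ≤ Z ∧
      Z ≤ C * (N : ℝ) ^ D ∧ S ⊆ Finset.Icc 1 N ×ˢ Finset.Icc 1 N ∧ S.Nonempty ∧
      (∀ p ∈ S, p.1 ≠ p.2) ∧ (∀ p ∈ S, Z ≤ x p.1 - x p.2 ∧ x p.1 - x p.2 < 2 * Z) ∧
      (N : ℝ) ^ 2 ≤ M * (N : ℝ) ^ η * S.card := by
  -- The number of dyadic classes is logarithmic in `N`; through `log y ≤ y^θ/θ` and `Dθ ≤ η` it is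
  -- `O(N^η)`.
  set θ := η / (D + 1) with hθ
  have hθ0 : 0 < θ := by positivity
  set Q : ℝ := (C / c) ^ θ / θ / Real.log 2 with hQ
  have hlog2 : 0 < Real.log 2 := Real.log_pos one_lt_two
  have hQ0 : 0 < Q := by positivity
  refine ⟨8 * (Q + 1), by positivity, fun N hN => ?_⟩
  have hN1 : (1 : ℝ) ≤ N := by exact_mod_cast (by omega : 1 ≤ N)
  have hNη : 1 ≤ (N : ℝ) ^ η := Real.one_le_rpow hN1 hη.le
  -- Pairing the upper half of the indices with the lower half gives at least `N²/8` pairs, all with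
  -- positive difference.
  set T := Finset.Ioc (N / 2) N ×ˢ Finset.Icc 1 (N / 2) with hT
  have hTsub : ∀ p ∈ T, (1 ≤ p.1 ∧ p.1 ≤ N) ∧ (1 ≤ p.2 ∧ p.2 ≤ N) ∧ p.2 < p.1 := fun p hp => by
    rw [hT, Finset.mem_product, Finset.mem_Ioc, Finset.mem_Icc] at hp
    omega
  have hTcard : (N : ℝ) ^ 2 ≤ 8 * T.card := by
    rw [hT, Finset.card_product, Nat.card_Ioc, Nat.card_Icc, Nat.add_sub_cancel]
    have h1 : N ≤ 2 * (N - N / 2) := by omega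
    have h2 : N ≤ 4 * (N / 2) := by omega
    have := Nat.mul_le_mul h1 h2
    have h3 : N ^ 2 ≤ 8 * ((N - N / 2) * (N / 2)) := by
      rw [sq]
      refine this.trans_eq (by ring)
    exact_mod_cast h3
  have hzc : ∀ p ∈ T, c ≤ x p.1 - x p.2 := fun p hp =>
    add_le_of_gap hc hgap (hTsub p hp).2.1.1 (hTsub p hp).2.2
  have hzC : ∀ p ∈ T, x p.1 - x p.2 ≤ C * (N : ℝ) ^ D := fun p hp => by
    obtain ⟨⟨h1, h2⟩, ⟨h3, h4⟩, h5⟩ := hTsub p hp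
    have h6 : (p.1 : ℝ) ^ D ≤ (N : ℝ) ^ D := by
      gcongr
    calc x p.1 - x p.2 ≤ x p.1 := by linarith [hpos _ h3]
      _ ≤ C * (p.1 : ℝ) ^ D := hgrowth _ h1
      _ ≤ _ := by gcongr
  set k : ℕ × ℕ → ℕ := fun p => ⌊Real.logb 2 ((x p.1 - x p.2) / c)⌋₊ with hk
  set L : ℕ := ⌊Q * (N : ℝ) ^ η⌋₊ with hL
  have hmaps : ∀ p ∈ T, k p ∈ Finset.range (L + 1) := fun p hp => by
    rw [Finset.mem_range, Nat.lt_succ_iff]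
    refine Nat.floor_le_floor ?_
    have h1 := hzc p hp
    have h2 := hzC p hp
    have h0 : 0 < (x p.1 - x p.2) / c := div_pos (by linarith) hc
    rw [Real.logb, hQ]
    calc Real.log ((x p.1 - x p.2) / c) / Real.log 2
        ≤ ((x p.1 - x p.2) / c) ^ θ / θ / Real.log 2 := by
          gcongr
          exact Real.log_le_rpow_div h0.le hθ0
      _ ≤ (C / c * (N : ℝ) ^ D) ^ θ / θ / Real.log 2 := by
          gcongr
          rw [div_mul_eq_mul_div]
          gcongr
      _ = (C / c) ^ θ / θ / Real.log 2 * (N : ℝ) ^ (D * θ) := by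
          rw [Real.mul_rpow (by positivity) (by positivity), ← Real.rpow_mul (by positivity)]
          ring
      _ ≤ _ := by
          gcongr
          rw [hθ, mul_div_assoc', div_le_iff₀ (by positivity)]
          nlinarith
  obtain ⟨j, -, hcard⟩ := Finset.exists_le_card_fiber_of_nsmul_le_card_of_maps_to
    (b := (T.card : ℝ) / (L + 1)) hmaps ⟨0, by simp⟩ (by
      rw [Finset.card_range, nsmul_eq_mul]
      push_cast
      rw [mul_div_cancel₀ _ (by positivity)])
  set S := T.filter fun p => k p = j with hS
  have hST : ∀ p ∈ S, p ∈ T ∧ k p = j := fun p hp => Finset.mem_filter.1 hp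
  have hT0 : (0 : ℝ) < T.card := by nlinarith
  have hS0 : (0 : ℝ) < S.card := lt_of_lt_of_le (by positivity) hcard
  have hSne : S.Nonempty := Finset.card_pos.1 (by exact_mod_cast hS0)
  have hclass : ∀ p ∈ S, c * 2 ^ j ≤ x p.1 - x p.2 ∧ x p.1 - x p.2 < 2 * (c * 2 ^ j) :=
    fun p hp => by
    obtain ⟨hp1, hp2⟩ := hST p hp
    have h1 := hzc p hp1
    have h0 : 0 < (x p.1 - x p.2) / c := div_pos (by linarith) hc
    have hlog : 0 ≤ Real.logb 2 ((x p.1 - x p.2) / c) :=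
      Real.logb_nonneg one_lt_two ((one_le_div hc).2 h1)
    have h2 := Nat.floor_le hlog
    have h3 := Nat.lt_floor_add_one (Real.logb 2 ((x p.1 - x p.2) / c))
    change (k p : ℝ) ≤ _ at h2
    change _ < (k p : ℝ) + 1 at h3
    rw [hp2, Real.le_logb_iff_rpow_le one_lt_two h0, Real.rpow_natCast, le_div_iff₀ hc] at h2
    rw [hp2, Real.logb_lt_iff_lt_rpow one_lt_two h0, div_lt_iff₀ hc] at h3
    rw [Real.rpow_add two_pos, Real.rpow_one, Real.rpow_natCast] at h3
    exact ⟨by linarith, by linarith⟩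
  refine ⟨c * 2 ^ j, S, ?_, ?_, ?_, hSne, ?_, hclass, ?_⟩
  · exact le_mul_of_one_le_right hc.le (one_le_pow₀ one_le_two)
  · obtain ⟨p, hp⟩ := hSne
    exact (hclass p hp).1.trans (hzC p (hST p hp).1)
  · intro p hp
    obtain ⟨h1, h2, -⟩ := hTsub p (hST p hp).1
    exact Finset.mem_product.2 ⟨Finset.mem_Icc.2 h1, Finset.mem_Icc.2 h2⟩
  · intro p hp
    exact (hTsub p (hST p hp).1).2.2.ne'
  · have hL1 : (L : ℝ) + 1 ≤ (Q + 1) * (N : ℝ) ^ η := by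
      have : (L : ℝ) ≤ Q * (N : ℝ) ^ η := Nat.floor_le (by positivity)
      linarith
    rw [div_le_iff₀ (by positivity)] at hcard
    calc (N : ℝ) ^ 2 ≤ 8 * T.card := hTcard
      _ ≤ 8 * (S.card * (L + 1)) := by gcongr
      _ ≤ 8 * (S.card * ((Q + 1) * (N : ℝ) ^ η)) := by gcongr
      _ = _ := by ring

theorem EnergyBound.exists_bound {x : ℕ → ℝ} {β : ℝ} (h : EnergyBound x β) {ε : ℝ} (hε : 0 < ε) :
    ∃ C : ℝ, 0 < C ∧ ∀ N : ℕ, 1 ≤ N → (additiveEnergy x N : ℝ) ≤ C * (N : ℝ) ^ (β + ε) := by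
  obtain ⟨C, hC, h⟩ := bound_of_isBigO_nat_atTop (h ε hε)
  refine ⟨C, hC, fun N hN => ?_⟩
  have hN1 : (1 : ℝ) ≤ N := by exact_mod_cast hN
  have hpos : 0 < (N : ℝ) ^ (β + ε) := by positivity
  have := h hpos.ne'
  rwa [Real.norm_of_nonneg hpos.le, Real.norm_of_nonneg (Nat.cast_nonneg _)] at this

theorem exists_mul_exp_neg_le (b : ℝ) :
    ∃ C : ℝ, 0 < C ∧ ∀ w : ℝ, 1 ≤ w → w * Real.exp (-w) ≤ C * w ^ (-b) := by
  obtain ⟨n, hn⟩ := exists_nat_ge (b + 1)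
  refine ⟨n.factorial, by positivity, fun w hw => ?_⟩
  have hw0 : 0 < w := by linarith
  have h1 := Real.pow_div_factorial_le_exp w hw0.le n
  rw [div_le_iff₀ (by positivity)] at h1
  have h2 : w ^ (b + 1) ≤ w ^ n := by
    rw [← Real.rpow_natCast]
    gcongr
  rw [Real.rpow_neg hw0.le, Real.exp_neg, ← div_eq_mul_inv, ← div_eq_mul_inv,
    div_le_div_iff₀ (Real.exp_pos _) (by positivity)]
  calc w * w ^ b = w ^ (b + 1) := by rw [Real.rpow_add hw0, Real.rpow_one]; ring
    _ ≤ w ^ n := h2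
    _ ≤ _ := by linarith

/-- Each of the three terms of the measure bound is made `O(N^(-ε/2))`. In the energy term the
exponents are `(β + ε/4) + (ε/4 - 4) + κ`. The factor `R^(2ε')` costs at most `N^(ε/4)`. -/
theorem LindelofHypothesis.volume_largeGapSet_rpow_le (hLH : LindelofHypothesis) {x : ℕ → ℝ}
    (hpos : ∀ n : ℕ, 1 ≤ n → 0 < x n) {c C D : ℝ}
    (hc : 0 < c) (hgap : ∀ n : ℕ, 1 ≤ n → c ≤ x (n + 1) - x n) (hC : 0 < C) (hD : 0 ≤ D)
    (hgrowth : ∀ n : ℕ, 1 ≤ n → x n ≤ C * (n : ℝ) ^ D) {K : ℝ} (hK : 1 ≤ K) (hKc : 1 ≤ K * c)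
    {β : ℝ} (hβ : EnergyBound x β) {ε : ℝ} (hε : 0 < ε) (hκ : 0 < 4 - β - ε) :
    ∃ M : ℝ, 0 < M ∧ ∀ N : ℕ, 2 ≤ N →
      volume (largeGapSet x N K ((N : ℝ) ^ (-(4 - β - ε)))) ≤
        ENNReal.ofReal (M * (N : ℝ) ^ (-(ε / 4))) := by
  set κ := 4 - β - ε with hκdef
  obtain ⟨CE, hCE, hE⟩ := hβ.exists_bound (ε := ε / 4) (by positivity)
  obtain ⟨M, hM, hclass⟩ := exists_dyadic_class hpos hc hgap hC hD hgrowth (η := ε / 8)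
    (by positivity)
  obtain ⟨CX, hCX, hX⟩ := exists_mul_exp_neg_le (ε / (2 * κ))
  -- The cutoff is `R = N^m`; this `m` makes `N^D R^(-1/2) δ^(-2) = N^(-ε/2)`.
  set m : ℝ := 2 * (D + 2 * κ + ε / 2) with hm
  have hm0 : 0 < m := by positivity
  -- Chosen after `m`, so that `2mε' ≤ ε/4`.
  set ε' : ℝ := min (1 / 4) (ε / (8 * m)) with hε'
  have hε'0 : 0 < ε' := lt_min (by norm_num) (by positivity)
  obtain ⟨CV, hCV, hV⟩ := hLH.volume_largeGapSet_le hε'0 (min_le_left _ _)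
  have hK0 : 0 < K := by linarith
  refine ⟨CV * K ^ 4 * (CE * M ^ 2 + CX + C), by positivity, fun N hN => ?_⟩
  obtain ⟨Z, S, hcZ, hZC, hS, hSne, hSd, hz, hcard⟩ := hclass N hN
  have hN1 : (1 : ℝ) ≤ N := by exact_mod_cast (by omega : 1 ≤ N)
  have hN0 : (0 : ℝ) < N := by linarith
  set n : ℝ := (N : ℝ) with hn
  set δ := n ^ (-κ) with hδ
  have hδ0 : 0 < δ := by positivity
  have hδ1 : δ ≤ 1 := Real.rpow_le_one_of_one_le_of_nonpos hN1 (by linarith)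
  have hδinv : 1 / δ = n ^ κ := by rw [hδ, Real.rpow_neg hN0.le, one_div, inv_inv]
  have hA : (0 : ℝ) < S.card := by exact_mod_cast hSne.card_pos
  refine (hV x N S Z K δ (n ^ m) hS hSne hSd hz (hc.trans_le hcZ) hK
    (hKc.trans (by gcongr)) hδ0 hδ1 (Real.one_le_rpow hN1 hm0.le)).trans
    (ENNReal.ofReal_le_ofReal ?_)
  have h1 : (n ^ m) ^ (2 * ε') ≤ n ^ (ε / 4) := by
    rw [← Real.rpow_mul hN0.le]
    gcongr
    have : ε' ≤ ε / (8 * m) := min_le_right _ _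
    rw [le_div_iff₀ (by positivity)] at this
    linarith
  have h2 : additiveEnergy x N / ((S.card : ℝ) ^ 2 * δ) ≤ CE * M ^ 2 * n ^ (-(ε / 2)) := by
    rw [div_le_iff₀ (by positivity)]
    have h3 : n ^ (4 : ℝ) ≤ M ^ 2 * n ^ (ε / 4) * (S.card : ℝ) ^ 2 := by
      calc n ^ (4 : ℝ) = (n ^ 2) ^ 2 := by
            rw [← pow_mul, ← Real.rpow_natCast]
            norm_num
        _ ≤ (M * n ^ (ε / 8) * S.card) ^ 2 := by gcongr
        _ = M ^ 2 * (n ^ (ε / 8)) ^ 2 * (S.card : ℝ) ^ 2 := by ring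
        _ = _ := by
          rw [← Real.rpow_natCast (n ^ (ε / 8)), ← Real.rpow_mul hN0.le]
          ring_nf
    calc (additiveEnergy x N : ℝ) ≤ CE * n ^ (β + ε / 4) := hE N (by omega)
      _ = CE * n ^ (-(ε / 2)) * δ * n ^ (-(ε / 4)) * n ^ (4 : ℝ) := by
        rw [hδ, mul_assoc, mul_assoc, mul_assoc, ← Real.rpow_add hN0, ← Real.rpow_add hN0,
          ← Real.rpow_add hN0, hκdef]
        ring_nf
      _ ≤ CE * n ^ (-(ε / 2)) * δ * n ^ (-(ε / 4)) *
          (M ^ 2 * n ^ (ε / 4) * (S.card : ℝ) ^ 2) := by gcongr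
      _ = CE * M ^ 2 * n ^ (-(ε / 2)) * ((S.card : ℝ) ^ 2 * δ) *
          (n ^ (-(ε / 4)) * n ^ (ε / 4)) := by ring
      _ = _ := by
        rw [← Real.rpow_add hN0, neg_add_cancel, Real.rpow_zero, mul_one]
  have h4 : Real.exp (-(1 / δ)) / δ ≤ CX * n ^ (-(ε / 2)) := by
    have := hX (n ^ κ) (Real.one_le_rpow hN1 hκ.le)
    rw [← Real.rpow_mul hN0.le] at this
    rw [div_eq_mul_one_div, hδinv, mul_comm]
    refine this.trans_eq ?_
    congr 2
    field_simp
  have h5 : Z * (n ^ m) ^ (-(1 / 2) : ℝ) / δ ^ 2 ≤ C * n ^ (-(ε / 2)) := by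
    have e1 : Z * (n ^ m) ^ (-(1 / 2) : ℝ) / δ ^ 2 =
        Z * (n ^ (m * -(1 / 2)) * n ^ (κ * 2)) := by
      rw [div_eq_mul_one_div, ← one_div_pow, hδinv, ← Real.rpow_mul hN0.le,
        ← Real.rpow_natCast (n ^ κ), ← Real.rpow_mul hN0.le, mul_assoc]
      norm_num
    rw [e1]
    calc _ ≤ C * n ^ D * (n ^ (m * -(1 / 2)) * n ^ (κ * 2)) := by gcongr
      _ = _ := by
        rw [mul_assoc, ← Real.rpow_add hN0, ← Real.rpow_add hN0, hm]
        ring_nf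
  calc _ ≤ CV * K ^ 4 * n ^ (ε / 4) * (CE * M ^ 2 * n ^ (-(ε / 2)) + CX * n ^ (-(ε / 2)) +
        C * n ^ (-(ε / 2))) := by
        have hZ0 : 0 < Z := hc.trans_le hcZ
        gcongr
    _ = CV * K ^ 4 * (CE * M ^ 2 + CX + C) * (n ^ (ε / 4) * n ^ (-(ε / 2))) := by ring
    _ = _ := by
      rw [← Real.rpow_add hN0]
      ring_nf

/-! ### Borel-Cantelli and interpolation between powers of two -/

theorem minGap_anti (y : ℕ → ℝ) {M N : ℕ} (hM : 2 ≤ M) (hMN : M ≤ N) :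
    minGap y N ≤ minGap y M := by
  obtain ⟨m, hm, n, hn, hmn, h⟩ := (isLeast_minGap y hM).1
  rw [h]
  exact minGap_le_distInt y (Finset.Icc_subset_Icc_right hMN hm)
    (Finset.Icc_subset_Icc_right hMN hn) hmn

/-- The Borel-Cantelli lemma along powers of two. -/
theorem ae_eventually_notMem_two_pow {s : ℕ → Set ℝ} {M θ : ℝ} (hθ : 0 < θ)
    (h : ∀ N : ℕ, 2 ≤ N → volume (s N) ≤ ENNReal.ofReal (M * (N : ℝ) ^ (-θ))) :
    ∀ᵐ α : ℝ, ∀ᶠ j : ℕ in atTop, α ∉ s (2 ^ j) := by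
  have hr1 : (2 : ℝ) ^ (-θ) < 1 := Real.rpow_lt_one_of_one_lt_of_neg one_lt_two (by linarith)
  -- The index starts at `j + 1` because the measure bound needs `2 ≤ N`.
  have hsum : Summable fun j : ℕ => M * ((2 : ℝ) ^ (-θ)) ^ (j + 1) := by
    simp_rw [pow_succ]
    exact ((summable_geometric_of_lt_one (by positivity) hr1).mul_right _).mul_left M
  have hfin : ∑' j : ℕ, volume (s (2 ^ (j + 1))) ≠ ⊤ := by
    refine ne_top_of_le_ne_top (hsum.tsum_ofReal_ne_top) (ENNReal.tsum_le_tsum fun j => ?_)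
    refine (h _ ?_).trans_eq ?_
    · calc 2 = 2 ^ 1 := by norm_num
        _ ≤ _ := Nat.pow_le_pow_right (by norm_num) (by omega)
    · congr 2
      push_cast
      rw [← Real.rpow_natCast, ← Real.rpow_natCast, ← Real.rpow_mul (by norm_num),
        ← Real.rpow_mul (by norm_num), mul_comm]
  filter_upwards [ae_eventually_notMem hfin] with α hα
  obtain ⟨J, hJ⟩ := eventually_atTop.1 hα
  refine eventually_atTop.2 ⟨J + 1, fun j hj => ?_⟩
  have := hJ (j - 1) (by omega)
  rwa [Nat.sub_add_cancel (by omega)] at this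

theorem eventually_const_mul_rpow_le (A : ℝ) {a b : ℝ} (hab : a < b) :
    ∀ᶠ N : ℕ in atTop, A * (N : ℝ) ^ a ≤ (N : ℝ) ^ b := by
  have h : Tendsto (fun N : ℕ => (N : ℝ) ^ (b - a)) atTop atTop :=
    (tendsto_rpow_atTop (by linarith)).comp tendsto_natCast_atTop_atTop
  filter_upwards [h.eventually_ge_atTop A, eventually_ge_atTop 1] with N hN hN1
  have hN0 : (0 : ℝ) < N := by exact_mod_cast hN1
  calc A * (N : ℝ) ^ a ≤ (N : ℝ) ^ (b - a) * (N : ℝ) ^ a := by gcongr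
    _ = _ := by rw [← Real.rpow_add hN0, sub_add_cancel]

theorem tendsto_nat_log_two : Tendsto (fun N : ℕ => Nat.log 2 N) atTop atTop :=
  tendsto_atTop.2 fun b => (eventually_ge_atTop (2 ^ b)).mono fun N hN =>
    Nat.le_log_of_pow_le (by norm_num) hN

/-- The gap decreases with `N`, so the preceding power of two, which is at least `N/2`, gives the
bound with a loss `2^κ` that the smaller exponent absorbs. The companion lower bound uses the
following power. -/
theorem eventually_minGap_lt_of_two_pow {y : ℕ → ℝ} {κ κ' : ℝ} (hκ : 0 < κ) (hκ' : κ' < κ)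
    (h : ∀ᶠ j : ℕ in atTop, minGap y (2 ^ j) < ((2 ^ j : ℕ) : ℝ) ^ (-κ)) :
    ∀ᶠ N : ℕ in atTop, minGap y N < (N : ℝ) ^ (-κ') := by
  filter_upwards [tendsto_nat_log_two.eventually h, eventually_ge_atTop 2,
    eventually_const_mul_rpow_le (2 ^ κ) (neg_lt_neg hκ')] with N hN hN2 hN3
  have h1 : 2 ^ Nat.log 2 N ≤ N := Nat.pow_log_le_self 2 (by omega)
  have h2 : N < 2 ^ (Nat.log 2 N + 1) := Nat.lt_pow_succ_log_self (by norm_num) N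
  have h3 : 2 ≤ 2 ^ Nat.log 2 N := by
    calc 2 = 2 ^ 1 := by norm_num
      _ ≤ _ := Nat.pow_le_pow_right (by norm_num) (Nat.log_pos (by norm_num) hN2)
  have hN0 : (0 : ℝ) < N := by exact_mod_cast (by omega : 0 < N)
  have h4 : (N : ℝ) / 2 ≤ ((2 ^ Nat.log 2 N : ℕ) : ℝ) := by
    rw [div_le_iff₀ two_pos]
    have : N ≤ 2 ^ Nat.log 2 N * 2 := by rw [← pow_succ]; exact h2.le
    exact_mod_cast this
  calc minGap y N ≤ minGap y (2 ^ Nat.log 2 N) := minGap_anti y h3 h1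
    _ < ((2 ^ Nat.log 2 N : ℕ) : ℝ) ^ (-κ) := hN
    _ ≤ ((N : ℝ) / 2) ^ (-κ) :=
        Real.rpow_le_rpow_of_nonpos (by positivity) h4 (by linarith)
    _ = 2 ^ κ * (N : ℝ) ^ (-κ) := by
        rw [Real.div_rpow hN0.le two_pos.le, Real.rpow_neg two_pos.le κ, div_inv_eq_mul, mul_comm]
    _ ≤ _ := hN3

theorem eventually_le_minGap_of_two_pow {y : ℕ → ℝ} {κ κ' : ℝ} (hκ : 0 < κ) (hκ' : κ < κ')
    (h : ∀ᶠ j : ℕ in atTop, ((2 ^ j : ℕ) : ℝ) ^ (-κ) ≤ minGap y (2 ^ j)) :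
    ∀ᶠ N : ℕ in atTop, (N : ℝ) ^ (-κ') ≤ minGap y N := by
  have hlog : Tendsto (fun N : ℕ => Nat.log 2 N + 1) atTop atTop :=
    (tendsto_add_atTop_nat 1).comp tendsto_nat_log_two
  filter_upwards [hlog.eventually h, eventually_ge_atTop 2,
    eventually_const_mul_rpow_le (2 ^ κ) (neg_lt_neg hκ')] with N hN hN2 hN3
  have h1 : 2 ^ Nat.log 2 N ≤ N := Nat.pow_log_le_self 2 (by omega)
  have h2 : N < 2 ^ (Nat.log 2 N + 1) := Nat.lt_pow_succ_log_self (by norm_num) N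
  have hN0 : (0 : ℝ) < N := by exact_mod_cast (by omega : 0 < N)
  have h4 : ((2 ^ (Nat.log 2 N + 1) : ℕ) : ℝ) ≤ 2 * N := by
    have : 2 ^ (Nat.log 2 N + 1) ≤ 2 * N := by rw [pow_succ]; omega
    exact_mod_cast this
  calc (N : ℝ) ^ (-κ') ≤ 2 ^ (-κ) * (N : ℝ) ^ (-κ) := by
        rw [Real.rpow_neg two_pos.le, ← div_eq_inv_mul, le_div_iff₀ (by positivity), mul_comm]
        exact hN3
    _ = (2 * (N : ℝ)) ^ (-κ) := by rw [Real.mul_rpow two_pos.le hN0.le]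
    _ ≤ ((2 ^ (Nat.log 2 N + 1) : ℕ) : ℝ) ^ (-κ) :=
        Real.rpow_le_rpow_of_nonpos (by positivity) h4 (by linarith)
    _ ≤ minGap y (2 ^ (Nat.log 2 N + 1)) := hN
    _ ≤ minGap y N := minGap_anti y hN2 h2.le

/-! ### Symmetry under negation and the union bound for small gaps -/

theorem distInt_neg (u : ℝ) : distInt (-u) = distInt u := by
  refine le_antisymm ?_ ?_
  · refine (distInt_le (-u) (-round u)).trans_eq ?_
    rw [distInt, ← abs_neg]
    congr 1
    push_cast
    ring
  · refine (distInt_le u (-round (-u))).trans_eq ?_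
    rw [distInt, ← abs_neg]
    congr 1
    push_cast
    ring

theorem minGap_neg (y : ℕ → ℝ) (N : ℕ) : minGap (fun n => -y n) N = minGap y N := by
  have : gapSet (fun n => -y n) N = gapSet y N := by
    ext d
    simp only [gapSet, Set.mem_ofPred_eq]
    have : ∀ m n, distInt (-y m - -y n) = distInt (y m - y n) := fun m n => by
      rw [← distInt_neg]
      congr 1
      ring
    simp only [this]
  rw [minGap, this, minGap]

theorem minGap_le_half (y : ℕ → ℝ) {N : ℕ} (hN : 2 ≤ N) : minGap y N ≤ 1 / 2 := by
  obtain ⟨m, _, n, _, _, h⟩ := (isLeast_minGap y hN).1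
  rw [h]
  exact abs_sub_round _

theorem minGap_nonneg (y : ℕ → ℝ) {N : ℕ} (hN : 2 ≤ N) : 0 ≤ minGap y N := by
  obtain ⟨m, _, n, _, _, h⟩ := (isLeast_minGap y hN).1
  rw [h]
  exact distInt_nonneg _

/-- Such `α` lie within `δ/|z|` of some `k/z`, with `O(K|z| + 1)` possible integers `k`. The total
length is `O(Kδ + δ/|z|)`, and `|z| ≥ c` makes this uniform. -/
theorem volume_distInt_mul_lt_le {K c δ z : ℝ} (hK : 0 < K) (hc : 0 < c) (hδ : 0 < δ)
    (hδ1 : δ ≤ 1) (hz : c ≤ |z|) :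
    volume {α | α ∈ Set.Icc (1 / K) K ∧ distInt (α * z) < δ} ≤
      ENNReal.ofReal ((4 * K + 10 / c) * δ) := by
  have hz0 : 0 < |z| := hc.trans_le hz
  have hzne : z ≠ 0 := abs_pos.1 hz0
  -- The extra `1` makes room for the distance from `αz` to its rounding.
  set J : ℤ := ⌈K * |z|⌉ + 1 with hJ
  have hJ0 : 0 ≤ J := by
    have := Int.ceil_nonneg (by positivity : 0 ≤ K * |z|)
    omega
  have hsub : {α | α ∈ Set.Icc (1 / K) K ∧ distInt (α * z) < δ} ⊆
      ⋃ k ∈ Finset.Icc (-J) J, Metric.ball ((k : ℝ) / z) (δ / |z|) := by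
    rintro α ⟨⟨h1, h2⟩, h3⟩
    have hα0 : 0 < α := lt_of_lt_of_le (by positivity) h1
    have hb : |α * z| ≤ K * |z| := by
      rw [abs_mul, abs_of_pos hα0]
      gcongr
    rw [distInt] at h3
    have h4 : |(round (α * z) : ℝ)| ≤ J := by
      have h5 := abs_sub_abs_le_abs_sub (round (α * z) : ℝ) (α * z)
      rw [abs_sub_comm] at h5
      have h6 := Int.le_ceil (K * |z|)
      rw [hJ]
      push_cast
      linarith
    refine Set.mem_iUnion₂.2 ⟨round (α * z), ?_, ?_⟩
    · rw [Finset.mem_Icc]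
      obtain ⟨h5, h6⟩ := abs_le.1 h4
      exact ⟨by exact_mod_cast h5, by exact_mod_cast h6⟩
    · rw [Metric.mem_ball, Real.dist_eq, lt_div_iff₀ hz0, ← abs_mul, sub_mul,
        div_mul_cancel₀ _ hzne]
      exact h3
  refine (measure_mono hsub).trans ((measure_biUnion_finset_le _ _).trans ?_)
  simp only [Real.volume_ball, Finset.sum_const, Int.card_Icc]
  rw [← ENNReal.ofReal_nsmul]
  refine ENNReal.ofReal_le_ofReal ?_
  have hcard : (((J + 1 - -J).toNat : ℕ) : ℝ) = 2 * J + 1 := by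
    have : (((J + 1 - -J).toNat : ℕ) : ℤ) = 2 * J + 1 := by
      rw [Int.toNat_of_nonneg (by omega)]
      ring
    exact_mod_cast this
  rw [nsmul_eq_mul, hcard]
  have hJle : (J : ℝ) ≤ K * |z| + 2 := by
    have := Int.ceil_lt_add_one (K * |z|)
    rw [hJ]
    push_cast
    linarith
  calc (2 * (J : ℝ) + 1) * (2 * (δ / |z|)) ≤ (2 * (K * |z| + 2) + 1) * (2 * (δ / |z|)) := by
        gcongr
    _ = (4 * K + 10 / |z|) * δ := by
        field_simp
        ring
    _ ≤ _ := by gcongr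

/-- The set of `α` in `[1/K, K]` for which the minimal gap is less than `δ`. -/
def smallGapSet (x : ℕ → ℝ) (N : ℕ) (K δ : ℝ) : Set ℝ :=
  {α | α ∈ Set.Icc (1 / K) K ∧ minGap (fun n => α * x n) N < δ}

theorem le_abs_sub_of_gap {x : ℕ → ℝ} {c : ℝ} (hc : 0 < c)
    (hgap : ∀ n : ℕ, 1 ≤ n → c ≤ x (n + 1) - x n) {m n : ℕ} (hm : 1 ≤ m) (hn : 1 ≤ n)
    (hmn : m ≠ n) : c ≤ |x m - x n| := by
  rcases lt_or_gt_of_ne hmn with h | h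
  · rw [abs_sub_comm]
    exact (add_le_of_gap hc hgap hm h).trans (le_abs_self _)
  · exact (add_le_of_gap hc hgap hn h).trans (le_abs_self _)

theorem volume_smallGapSet_le {x : ℕ → ℝ} {c K δ : ℝ} (hc : 0 < c)
    (hgap : ∀ n : ℕ, 1 ≤ n → c ≤ x (n + 1) - x n) (hK : 0 < K) (hδ : 0 < δ) (hδ1 : δ ≤ 1)
    {N : ℕ} (hN : 2 ≤ N) :
    volume (smallGapSet x N K δ) ≤ ENNReal.ofReal ((4 * K + 10 / c) * (N : ℝ) ^ 2 * δ) := by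
  have hsub : smallGapSet x N K δ ⊆ ⋃ p ∈ (Finset.Icc 1 N).offDiag,
      {α | α ∈ Set.Icc (1 / K) K ∧ distInt (α * (x p.1 - x p.2)) < δ} := by
    rintro α ⟨hα, hlt⟩
    obtain ⟨m, hm, n, hn, hmn, h⟩ := (isLeast_minGap (fun n => α * x n) hN).1
    refine Set.mem_iUnion₂.2 ⟨(m, n), Finset.mem_offDiag.2 ⟨hm, hn, hmn⟩, hα, ?_⟩
    rw [mul_sub]
    exact h ▸ hlt
  refine (measure_mono hsub).trans ((measure_biUnion_finset_le _ _).trans ?_)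
  refine (Finset.sum_le_card_nsmul _ _ (ENNReal.ofReal ((4 * K + 10 / c) * δ)) fun p hp => ?_).trans
    ?_
  · obtain ⟨h1, h2, h3⟩ := Finset.mem_offDiag.1 hp
    exact volume_distInt_mul_lt_le hK hc hδ hδ1
      (le_abs_sub_of_gap hc hgap (Finset.mem_Icc.1 h1).1 (Finset.mem_Icc.1 h2).1 h3)
  · rw [← ENNReal.ofReal_nsmul, nsmul_eq_mul]
    refine ENNReal.ofReal_le_ofReal ?_
    have h1 : ((Finset.Icc 1 N).offDiag.card : ℝ) ≤ (N : ℝ) ^ 2 := by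
      have : (Finset.Icc 1 N).offDiag.card ≤ N ^ 2 := by
        rw [Finset.offDiag_card, Nat.card_Icc, Nat.add_sub_cancel, sq]
        exact Nat.sub_le _ _
      exact_mod_cast this
    calc _ ≤ (N : ℝ) ^ 2 * ((4 * K + 10 / c) * δ) := by gcongr
      _ = _ := by ring

/-! ### Almost everywhere bounds with loss `ε` -/

/-- A property invariant under `α ↦ -α` holds almost everywhere as soon as it does on the
intervals `[1/K, K]`. -/
theorem ae_of_forall_Icc {P : ℝ → Prop} (hneg : ∀ α, P (-α) → P α) (K₀ : ℕ)
    (h : ∀ K : ℕ, K₀ ≤ K → ∀ᵐ α : ℝ, α ∈ Set.Icc (1 / (K : ℝ)) K → P α) : ∀ᵐ α : ℝ, P α := by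
  have h1 : ∀ᵐ α : ℝ, 0 < α → P α := by
    have h2 : ∀ᵐ α : ℝ, ∀ K : ℕ, K₀ ≤ K → α ∈ Set.Icc (1 / (K : ℝ)) K → P α := by
      rw [ae_all_iff]
      intro K
      by_cases hK : K₀ ≤ K
      · filter_upwards [h K hK] with α hα _ using hα
      · exact Eventually.of_forall fun _ hK' => absurd hK' hK
    filter_upwards [h2] with α hα h0
    obtain ⟨a, ha⟩ := exists_nat_ge α
    obtain ⟨b, hb⟩ := exists_nat_ge (1 / α)
    refine hα (max K₀ (max a b)) (le_max_left _ _) ⟨?_, ?_⟩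
    · have h3 : 1 / α ≤ ((max K₀ (max a b) : ℕ) : ℝ) :=
        hb.trans (by exact_mod_cast (le_max_right a b).trans (le_max_right _ _))
      rw [one_div_le (lt_of_lt_of_le (by positivity) h3) h0]
      exact h3
    · exact ha.trans (by exact_mod_cast (le_max_left a b).trans (le_max_right _ _))
  have h3 : ∀ᵐ α : ℝ, 0 < -α → P (-α) :=
    (Measure.measurePreserving_neg (volume : Measure ℝ)).quasiMeasurePreserving.ae h1
  filter_upwards [h1, h3, compl_mem_ae_iff.2 (measure_singleton (0 : ℝ))] with α h4 h5 h6
  rcases lt_or_gt_of_ne (show α ≠ 0 from h6) with h | h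
  · exact hneg α (h5 (by linarith))
  · exact h4 h

theorem ae_eventually_le_minGap {x : ℕ → ℝ} {c : ℝ} (hc : 0 < c)
    (hgap : ∀ n : ℕ, 1 ≤ n → c ≤ x (n + 1) - x n) {ε : ℝ} (hε : 0 < ε) :
    ∀ᵐ α : ℝ, ∀ᶠ N : ℕ in atTop, (N : ℝ) ^ (-(2 + ε)) ≤ minGap (fun n => α * x n) N := by
  refine ae_of_forall_Icc (fun α h => ?_) 1 fun K hK => ?_
  · have : ∀ N, minGap (fun n => -α * x n) N = minGap (fun n => α * x n) N := fun N => by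
      simpa only [neg_mul] using minGap_neg (fun n => α * x n) N
    simpa only [this] using h
  have hK0 : (0 : ℝ) < K := by exact_mod_cast hK
  have hbc := ae_eventually_notMem_two_pow
    (s := fun N => smallGapSet x N K ((N : ℝ) ^ (-(2 + ε / 2)))) (M := 4 * K + 10 / c)
    (θ := ε / 2) (by positivity) fun N hN => by
      have hN1 : (1 : ℝ) ≤ N := by exact_mod_cast (by omega : 1 ≤ N)
      have hN0 : (0 : ℝ) < N := by linarith
      refine (volume_smallGapSet_le hc hgap hK0 (by positivity)
        (Real.rpow_le_one_of_one_le_of_nonpos hN1 (by linarith)) hN).trans_eq ?_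
      rw [mul_assoc, ← Real.rpow_natCast (N : ℝ) 2, ← Real.rpow_add hN0]
      congr 3
      push_cast
      ring
  filter_upwards [hbc] with α hα hmem
  refine eventually_le_minGap_of_two_pow (κ := 2 + ε / 2) (by positivity) (by linarith) ?_
  filter_upwards [hα] with j hj
  by_contra hlt
  exact hj ⟨hmem, not_le.1 hlt⟩

theorem LindelofHypothesis.ae_eventually_minGap_lt (hLH : LindelofHypothesis) {x : ℕ → ℝ}
    (hpos : ∀ n : ℕ, 1 ≤ n → 0 < x n) {c : ℝ}
    (hc : 0 < c) (hgap : ∀ n : ℕ, 1 ≤ n → c ≤ x (n + 1) - x n)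
    (hgrowth : ∃ C : ℝ, x =O[atTop] (fun n : ℕ => (n : ℝ) ^ C))
    {β : ℝ} (hβ : EnergyBound x β) {ε : ℝ} (hε : 0 < ε) :
    ∀ᵐ α : ℝ, ∀ᶠ N : ℕ in atTop,
      minGap (fun n => α * x n) N < (N : ℝ) ^ (-(4 - β - ε)) := by
  -- For a nonpositive exponent the right side is at least `1`, while the gap never exceeds `1/2`.
  rcases le_or_gt (4 - β - ε) 0 with h4 | h4
  · refine Eventually.of_forall fun α => ?_
    filter_upwards [eventually_ge_atTop 2] with N hN
    have hN1 : (1 : ℝ) ≤ N := by exact_mod_cast (by omega : 1 ≤ N)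
    have h1 : (1 : ℝ) ≤ (N : ℝ) ^ (-(4 - β - ε)) := Real.one_le_rpow hN1 (by linarith)
    have h2 := minGap_le_half (fun n => α * x n) hN
    linarith
  obtain ⟨C, D, hC, hD, hCD⟩ := exists_growth_bound hgrowth
  -- `K ≥ 1/c` gives `KZ ≥ 1` for every dyadic class, which keeps `τ ≤ 1`.
  obtain ⟨K₀, hK₀⟩ := exists_nat_ge (max 1 (1 / c))
  refine ae_of_forall_Icc (fun α h => ?_) K₀ fun K hK => ?_
  · have : ∀ N, minGap (fun n => -α * x n) N = minGap (fun n => α * x n) N := fun N => by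
      simpa only [neg_mul] using minGap_neg (fun n => α * x n) N
    simpa only [this] using h
  have hKK : (K₀ : ℝ) ≤ K := by exact_mod_cast hK
  have hK1 : (1 : ℝ) ≤ K := (le_max_left _ _).trans (hK₀.trans hKK)
  have hKc : 1 ≤ (K : ℝ) * c := by
    rw [← div_le_iff₀ hc]
    exact (le_max_right _ _).trans (hK₀.trans hKK)
  obtain ⟨M, -, hV⟩ := hLH.volume_largeGapSet_rpow_le hpos hc hgap hC hD hCD hK1 hKc hβ
    (ε := ε / 2) (by positivity) (by linarith)
  have hbc := ae_eventually_notMem_two_pow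
    (s := fun N => largeGapSet x N K ((N : ℝ) ^ (-(4 - β - ε / 2)))) (by positivity) hV
  filter_upwards [hbc] with α hα hmem
  refine eventually_minGap_lt_of_two_pow (κ := 4 - β - ε / 2) (by linarith) (by linarith) ?_
  filter_upwards [hα] with j hj
  by_contra hlt
  exact hj ⟨hmem, not_lt.1 hlt⟩

/-! ### From every `ε` to a vanishing exponent -/

theorem ae_forall_pos {P : ℝ → ℝ → Prop} (hmono : ∀ α ε ε', ε ≤ ε' → P ε α → P ε' α)
    (h : ∀ ε, 0 < ε → ∀ᵐ α : ℝ, P ε α) : ∀ᵐ α : ℝ, ∀ ε, 0 < ε → P ε α := by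
  have : ∀ᵐ α : ℝ, ∀ n : ℕ, P (1 / ((n : ℝ) + 1)) α :=
    ae_all_iff.2 fun n => h _ Nat.one_div_pos_of_nat
  filter_upwards [this] with α hα ε hε
  obtain ⟨n, hn⟩ := exists_nat_one_div_lt hε
  exact hmono α _ _ hn.le (hα n)

theorem eventually_rpow_mono {f : ℕ → ℝ} {a b : ℝ} (hab : a ≤ b)
    (h : ∀ᶠ N : ℕ in atTop, f N < (N : ℝ) ^ a) : ∀ᶠ N : ℕ in atTop, f N < (N : ℝ) ^ b := by
  filter_upwards [h, eventually_ge_atTop 1] with N hN hN1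
  exact hN.trans_le (Real.rpow_le_rpow_of_exponent_le (by exact_mod_cast hN1) hab)

/-- Bounds with arbitrarily small loss in the exponent give a bound with vanishing loss. -/
theorem exists_tendsto_zero_lt {f : ℕ → ℝ} {κ : ℝ} (hf : ∀ N, 2 ≤ N → 0 ≤ f N)
    (h : ∀ ε, 0 < ε → ∀ᶠ N : ℕ in atTop, f N < (N : ℝ) ^ (-(κ - ε))) :
    ∃ η : ℕ → ℝ, Tendsto η atTop (𝓝 0) ∧ ∀ N : ℕ, 2 ≤ N → f N < 1 / (N : ℝ) ^ (κ - η N) := by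
  classical
  -- The summand `1/N` makes the inequality strict. The case `f N = 0` is separated because the
  -- logarithm carries no information there; the maximum with `0` leaves only an upper estimate to
  -- prove.
  refine ⟨fun N => (if f N = 0 then 0 else max 0 (κ + Real.logb N (f N))) + 1 / (N : ℝ), ?_,
    fun N hN => ?_⟩
  · suffices h : Tendsto (fun N : ℕ => if f N = 0 then 0 else max 0 (κ + Real.logb N (f N)))
        atTop (𝓝 0) by
      have := h.add (tendsto_one_div_atTop_nhds_zero_nat (𝕜 := ℝ))
      rwa [add_zero] at this
    rw [Metric.tendsto_nhds]
    intro ε hε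
    filter_upwards [h (ε / 2) (by positivity), eventually_ge_atTop 2] with N hN hN2
    split_ifs with h0
    · simpa using hε
    have hN1 : (1 : ℝ) < N := by exact_mod_cast (by omega : 1 < N)
    have hf0 : 0 < f N := lt_of_le_of_ne (hf N hN2) (Ne.symm h0)
    rw [Real.dist_eq, sub_zero, abs_of_nonneg (le_max_left _ _)]
    refine max_lt hε ?_
    have := (Real.logb_lt_iff_lt_rpow hN1 hf0).2 hN
    linarith
  · have hN1 : (1 : ℝ) < N := by exact_mod_cast (by omega : 1 < N)
    have hN0 : (0 : ℝ) < N := by linarith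
    rw [one_div, ← Real.rpow_neg hN0.le]
    by_cases h0 : f N = 0
    · rw [h0]
      positivity
    have hf0 : 0 < f N := lt_of_le_of_ne (hf N hN) (Ne.symm h0)
    rw [← Real.logb_lt_iff_lt_rpow hN1 hf0]
    simp only [if_neg h0]
    have h1 := le_max_right 0 (κ + Real.logb N (f N))
    have h2 : 0 < 1 / (N : ℝ) := by positivity
    linarith

/-- Two-sided bounds with arbitrarily small loss in the exponent give an asymptotic formula for
the exponent. -/
theorem exists_tendsto_zero_eq {f : ℕ → ℝ} {κ : ℝ} (hf : ∀ N, 2 ≤ N → 0 < f N)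
    (hup : ∀ ε, 0 < ε → ∀ᶠ N : ℕ in atTop, f N < (N : ℝ) ^ (-(κ - ε)))
    (hlow : ∀ ε, 0 < ε → ∀ᶠ N : ℕ in atTop, (N : ℝ) ^ (-(κ + ε)) ≤ f N) :
    ∃ η : ℕ → ℝ, Tendsto η atTop (𝓝 0) ∧ ∀ N : ℕ, 2 ≤ N → f N = 1 / (N : ℝ) ^ (κ + η N) := by
  refine ⟨fun N => -κ - Real.logb N (f N), ?_, fun N hN => ?_⟩
  · rw [Metric.tendsto_nhds]
    intro ε hε
    filter_upwards [hup (ε / 2) (by positivity), hlow (ε / 2) (by positivity),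
      eventually_ge_atTop 2] with N h1 h2 hN2
    have hN1 : (1 : ℝ) < N := by exact_mod_cast (by omega : 1 < N)
    rw [← Real.logb_lt_iff_lt_rpow hN1 (hf N hN2)] at h1
    rw [← Real.le_logb_iff_rpow_le hN1 (hf N hN2)] at h2
    rw [Real.dist_eq, sub_zero, abs_lt]
    constructor <;> linarith
  · have hN1 : (1 : ℝ) < N := by exact_mod_cast (by omega : 1 < N)
    have hN0 : (0 : ℝ) < N := by linarith
    rw [one_div, ← Real.rpow_neg hN0.le]
    have : -(κ + (-κ - Real.logb N (f N))) = Real.logb N (f N) := by ring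
    rw [this, Real.rpow_logb hN0 hN1.ne' (hf N hN)]

theorem theorem1p3 (hLH : LindelofHypothesis) (x : ℕ → ℝ)
    (hpos : ∀ n : ℕ, 1 ≤ n → 0 < x n)
    (hgap : ∃ c : ℝ, 0 < c ∧ ∀ n : ℕ, 1 ≤ n → c ≤ x (n + 1) - x n)
    (hgrowth : ∃ C : ℝ, x =O[atTop] (fun n : ℕ => (n : ℝ) ^ C)) :
    (∀ β : ℝ, EnergyBound x β →
      ∀ᵐ α : ℝ ∂volume, ∃ η : ℕ → ℝ, Tendsto η atTop (𝓝 0) ∧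
        ∀ N : ℕ, 2 ≤ N →
          minGap (fun n => α * x n) N < 1 / (N : ℝ) ^ (4 - β - η N)) ∧
    (EnergyBound x 2 →
      ∀ᵐ α : ℝ ∂volume, ∃ η : ℕ → ℝ, Tendsto η atTop (𝓝 0) ∧
        ∀ N : ℕ, 2 ≤ N →
          minGap (fun n => α * x n) N = 1 / (N : ℝ) ^ (2 + η N)) := by
  obtain ⟨c, hc, hgap⟩ := hgap
  have hupper : ∀ β : ℝ, EnergyBound x β → ∀ᵐ α : ℝ, ∀ ε, 0 < ε → ∀ᶠ N : ℕ in atTop,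
      minGap (fun n => α * x n) N < (N : ℝ) ^ (-(4 - β - ε)) := fun β hβ =>
    ae_forall_pos (fun α ε ε' hle h => eventually_rpow_mono (by linarith) h)
      fun ε hε => hLH.ae_eventually_minGap_lt hpos hc hgap hgrowth hβ hε
  have hlower : ∀ᵐ α : ℝ, ∀ ε : ℝ, 0 < ε → ∀ᶠ N : ℕ in atTop,
      (N : ℝ) ^ (-(2 + ε)) ≤ minGap (fun n => α * x n) N := by
    refine ae_forall_pos (fun α ε ε' hle h => ?_) fun ε hε => ae_eventually_le_minGap hc hgap hε
    filter_upwards [h, eventually_ge_atTop 1] with N hN hN1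
    exact (Real.rpow_le_rpow_of_exponent_le (by exact_mod_cast hN1) (by linarith)).trans hN
  refine ⟨fun β hβ => ?_, fun hβ => ?_⟩
  · filter_upwards [hupper β hβ] with α hα
    exact exists_tendsto_zero_lt (fun N hN => minGap_nonneg _ hN) hα
  · filter_upwards [hupper 2 hβ, hlower] with α h1 h2
    refine exists_tendsto_zero_eq (fun N hN => ?_) (fun ε hε => ?_) h2
    -- The lower bound holds only eventually; positivity at every `N` is inherited from a larger
    -- `M`, since the gap is decreasing.
    · obtain ⟨M, hM1, hM2⟩ := ((h2 1 one_pos).and (eventually_ge_atTop N)).exists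
      have hM0 : (0 : ℝ) < M := by exact_mod_cast (by omega : 0 < M)
      calc 0 < (M : ℝ) ^ (-(2 + 1) : ℝ) := by positivity
        _ ≤ _ := hM1
        _ ≤ _ := minGap_anti _ hN hM2
    · filter_upwards [h1 ε hε] with N hN
      convert hN using 2
      ring
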